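/- **Conventions.** $\mathcal{EL}$ concept expressions are built from countably infinite disjoint sets of concept names $A$ and role names $r$ by $C,D ::= \top \mid A \mid C\sqcap D\mid \exists r.C$. An $\mathcal{EL}$ concept inclusion (CI) is $C\sqsubseteq D$ with $C,D$ such expressions, and an $\mathcal{EL}$ TBox is a finite set of CIs. An interpretation consists of a non-empty domain, a subset of it for every concept name and a binary relation on it for every role name; $\mathcal T\models C\sqsubseteq D$ means that $C^{\mathcal I}\subseteq D^{\mathcal I}$ in every model $\mathcal I$ of $\mathcal T$. The size $|C|$ is the length of $C$ as a string with names of length one, $|C\sqsubseteq D|=|C|+|D|$, and $|\mathcal T|=\sum_{\alpha\in\mathcal T}|\alpha|$. The signature of $\mathcal T$ is the set of concept and role names that occur in it. A TBox is acyclic if it is a set of statements $A\sqsubseteq C$ and $A\equiv C$ (short for $A\sqsubseteq C$, $C\sqsubseteq A$), $A$ a concept name, such that no concept name is the left-hand side of two statements and there is no cyclic definition, that is, no sequence $\alpha_0,\dots,\alpha_n$ of statements such that the left-hand side of $\alpha_{i+1}$ occurs in the right-hand side of $\alpha_i$ for all $i<n$ and the left-hand side of $\alpha_0$ occurs in the right-hand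 side of $\alpha_n$. **Learning.** A deterministic learner (any function from the answers received so far to the next action, computable or not) is to identify an unknown target TBox $\mathcal T$ up to logical equivalence; it knows the signature of $\mathcal T$. A membership query is an $\mathcal{EL}$ CI $\alpha$ and is answered by whether $\mathcal T\models\alpha$. An equivalence query is a TBox $\mathcal H$; the answer is "yes" if $\mathcal H$ and $\mathcal T$ are logically equivalent and otherwise a counterexample, that is, a CI entailed by exactly one of $\mathcal H$ and $\mathcal T$, chosen arbitrarily by the oracle. A class of target TBoxes is polynomial query learnable using membership and equivalence queries, with hypotheses from a class $\mathfrak H$ of TBoxes, if there are a learner, whose equivalence queries and outputs are in $\mathfrak H$, and a polynomial $p$ such that for every target $\mathcal T$ in the class and all oracles for $\mathcal T$ the learner eventually halts with an output logically equivalent to $\mathcal T$, and at every step the sum of the sizes of the inputs to the queries made so far is at most $p(|\mathcal T|,|x|)$, where $x$ is the largest counterexample seen so far ($|x|=0$ if there is none). **Theorem.** Using membership and equivalence queries: 1. $\mathcal{EL}$ TBoxes are not polynomial query learnable (targets and hypotheses are arbitrary $\mathcal{EL}$ TBoxes). 2. Acyclic $\mathcal{EL}$ TBoxes are not polynomial query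 learnable with acyclic $\mathcal{EL}$ TBoxes as hypotheses. 3. Acyclic $\mathcal{EL}$ TBoxes are not polynomial query learnable even with arbitrary $\mathcal{EL}$ TBoxes as hypotheses. -/

import Mathlib

/-! ## The description logic EL -/

namespace EL

/-- EL concept expressions. The countably infinite sets of concept names and of role names
are two copies of `ℕ`. -/
inductive Concept : Type
  | top : Concept
  | atom : ℕ → Concept
  | inter : Concept → Concept → Concept
  | ex : ℕ → Concept → Concept

namespace Concept

/-- The length of a concept expression as a string; concept and role names have length one. -/
def size : Concept → ℕ
  | top => 1
  | atom _ => 1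
  | inter C D => C.size + 1 + D.size
  | ex _ C => 2 + C.size

/-- The concept names that occur in a concept expression. -/
def conceptNames : Concept → Finset ℕ
  | top => ∅
  | atom A => {A}
  | inter C D => C.conceptNames ∪ D.conceptNames
  | ex _ C => C.conceptNames

/-- The role names that occur in a concept expression. -/
def roleNames : Concept → Finset ℕ
  | top => ∅
  | atom _ => ∅
  | inter C D => C.roleNames ∪ D.roleNames
  | ex r C => {r} ∪ C.roleNames

end Concept

/-- A concept inclusion `lhs ⊑ rhs` between EL concept expressions. -/
structure CI : Type where
  lhs : Concept
  rhs : Concept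

/-- The size of a concept inclusion. -/
def CI.size (α : CI) : ℕ := α.lhs.size + α.rhs.size

/-- An EL TBox: a finite set of EL concept inclusions. -/
abbrev TBox : Type := Finset CI

/-- The size of a TBox. -/
def TBox.size (T : TBox) : ℕ := ∑ α ∈ T, α.size

/-- The signature of a TBox: the concept names and the role names that occur in it. -/
def TBox.sig (T : TBox) : Finset ℕ × Finset ℕ :=
  (T.biUnion fun α => α.lhs.conceptNames ∪ α.rhs.conceptNames,
   T.biUnion fun α => α.lhs.roleNames ∪ α.rhs.roleNames)

/-- Interpretations, with a non-empty domain. -/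
structure Interpretation : Type 1 where
  Dom : Type
  nonempty : Nonempty Dom
  concept : ℕ → Set Dom
  role : ℕ → Set (Dom × Dom)

/-- The extension of a concept expression in an interpretation. -/
def Interpretation.ext (I : Interpretation) : Concept → Set I.Dom
  | Concept.top => Set.univ
  | Concept.atom A => I.concept A
  | Concept.inter C D => I.ext C ∩ I.ext D
  | Concept.ex r C => {d | ∃ d' ∈ I.ext C, (d, d') ∈ I.role r}

/-- `I` satisfies the concept inclusion `α`. -/
def Interpretation.Satisfies (I : Interpretation) (α : CI) : Prop :=
  I.ext α.lhs ⊆ I.ext α.rhs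

/-- `I` is a model of the TBox `T`. -/
def Interpretation.IsModel (I : Interpretation) (T : TBox) : Prop :=
  ∀ α ∈ T, I.Satisfies α

/-- The TBox `T` entails the concept inclusion `α`. -/
def TBox.Entails (T : TBox) (α : CI) : Prop :=
  ∀ I : Interpretation, I.IsModel T → I.Satisfies α

/-- The two forms of statements allowed in an acyclic TBox: `A ⊑ C` and `A ≡ C`
with a concept name `A`. -/
inductive TermDef : Type
  | sub : ℕ → Concept → TermDef
  | equiv : ℕ → Concept → TermDef

namespace TermDef

/-- The concept name on the left-hand side. -/
def lhs : TermDef → ℕ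
  | sub A _ => A
  | equiv A _ => A

/-- The concept expression on the right-hand side. -/
def rhs : TermDef → Concept
  | sub _ C => C
  | equiv _ C => C

/-- The concept inclusions that the statement stands for: `A ≡ C` abbreviates
`A ⊑ C` and `C ⊑ A`. -/
def inclusions : TermDef → Set CI
  | sub A C => {⟨Concept.atom A, C⟩}
  | equiv A C => {⟨Concept.atom A, C⟩, ⟨C, Concept.atom A⟩}

end TermDef

/-- A TBox is acyclic if it consists of statements `A ⊑ C` and `A ≡ C` such that no concept
name is the left-hand side of two of them and no concept name refers, directly or
indirectly, to itself. -/
def TBox.Acyclic (T : TBox) : Prop :=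
  ∃ S : Finset TermDef,
    (∀ α : CI, α ∈ T ↔ ∃ δ ∈ S, α ∈ δ.inclusions) ∧
    (∀ δ ∈ S, ∀ δ' ∈ S, δ.lhs = δ'.lhs → δ = δ') ∧
    ∀ A : ℕ, ¬ Relation.TransGen
      (fun B B' : ℕ => ∃ δ ∈ S, δ.lhs = B ∧ B' ∈ δ.rhs.conceptNames) A A

end EL

/-! ## Exact learning with membership and equivalence queries -/

/-- A learning framework: examples `X`, concept representations `L`, and the set `μ l` of
positive examples of `l`; examples and representations have sizes. -/
structure LearningFramework : Type 1 where
  X : Type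
  L : Type
  μ : L → Set X
  sizeX : X → ℕ
  sizeL : L → ℕ

namespace LearningFramework

variable (F : LearningFramework)

/-- A query together with the answer it received: a membership query is answered by a truth
value; an equivalence query by `none` (for yes) or by a counterexample. -/
inductive Exchange : Type
  | mem : F.X → Bool → Exchange
  | equiv : F.L → Option F.X → Exchange

/-- What a learner does next: pose a query, or halt with an output. -/
inductive Action : Type
  | askMem : F.X → Action
  | askEquiv : F.L → Action
  | halt : F.L → Action

/-- A deterministic learner: it chooses its next action from the exchanges so far, the most
recent one first. Any such function is allowed; it need not be computable. -/
abbrev Learner : Type := List F.Exchange → F.Action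

/-- A membership oracle and an equivalence oracle for the target `l`. Which counterexamples
the equivalence oracle returns is up to the oracle. -/
structure Oracle (l : F.L) : Type where
  mem : F.X → Bool
  equiv : F.L → Option F.X
  mem_iff : ∀ x, mem x = true ↔ x ∈ F.μ l
  equiv_yes : ∀ h, F.μ h = F.μ l → equiv h = none
  equiv_no : ∀ h, F.μ h ≠ F.μ l → ∃ x ∈ symmDiff (F.μ h) (F.μ l), equiv h = some x

variable {F}

/-- The exchanges of the learner `A` with the oracle `O` within the first `k` steps. A learner
that has halted poses no further queries. -/
def transcript (A : F.Learner) {l : F.L} (O : F.Oracle l) : ℕ → List F.Exchange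
  | 0 => []
  | k + 1 =>
    match A (transcript A O k) with
    | Action.askMem x => Exchange.mem x (O.mem x) :: transcript A O k
    | Action.askEquiv h => Exchange.equiv h (O.equiv h) :: transcript A O k
    | Action.halt _ => transcript A O k

/-- The size of the input to a query. -/
def Exchange.inputSize : F.Exchange → ℕ
  | Exchange.mem x _ => F.sizeX x
  | Exchange.equiv h _ => F.sizeL h

/-- The size of the counterexample received, and `0` if there is none. -/
def Exchange.cexSize : F.Exchange → ℕ
  | Exchange.equiv _ (some x) => F.sizeX x
  | _ => 0

/-- The sum of the sizes of the inputs to all queries. -/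
def queryCost (t : List F.Exchange) : ℕ := (t.map Exchange.inputSize).sum

/-- The size of the largest counterexample received, and `0` if there is none. -/
def maxCexSize (t : List F.Exchange) : ℕ := (t.map Exchange.cexSize).foldr max 0

/-- Against every oracle for the target `l`, the learner `A` eventually halts with an output
that has the same positive examples as `l`. -/
def Identifies (A : F.Learner) (l : F.L) : Prop :=
  ∀ O : F.Oracle l, ∃ (k : ℕ) (h : F.L), A (transcript A O k) = Action.halt h ∧ F.μ h = F.μ l

/-- Against every oracle for the target `l` and at every step, the sum of the sizes of the
inputs to the queries made so far is at most `p(|l|, |x|)`, where `x` is the largest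
counterexample seen so far. -/
def QueryBounded (p : MvPolynomial (Fin 2) ℕ) (A : F.Learner) (l : F.L) : Prop :=
  ∀ (O : F.Oracle l) (k : ℕ),
    queryCost (transcript A O k) ≤
      MvPolynomial.eval ![F.sizeL l, maxCexSize (transcript A O k)] p

variable (F)

/-- The targets in `𝒯` are polynomial query learnable by a learner that knows `known l` of the
target `l` in advance; hypotheses and outputs may be arbitrary elements of `F.L`. -/
def PolyQueryLearnableOn {K : Type} (known : F.L → K) (𝒯 : Set F.L) : Prop :=
  ∃ (A : K → F.Learner) (p : MvPolynomial (Fin 2) ℕ),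
    ∀ l ∈ 𝒯, Identifies (A (known l)) l ∧ QueryBounded p (A (known l)) l

/-- The framework is polynomial query learnable by a learner that knows `known l` of the
target `l` in advance. -/
def PolyQueryLearnable {K : Type} (known : F.L → K) : Prop :=
  F.PolyQueryLearnableOn known Set.univ

end LearningFramework

namespace EL

/-- The learning framework of EL TBoxes. -/
def framework : LearningFramework where
  X := CI
  L := TBox
  μ := fun T => {α | T.Entails α}
  sizeX := CI.size
  sizeL := TBox.size

/-- The learning framework of acyclic EL TBoxes, with all EL concept inclusions as examples. -/
def acyclicFramework : LearningFramework where
  X := CI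
  L := {T : TBox // T.Acyclic}
  μ := fun T => {α | T.1.Entails α}
  sizeX := CI.size
  sizeL := fun T => T.1.size

end EL

/-! Each target hides a binary word σ of length n. Level names generate a binary tree of depth n
from L₀; each of 2n choice names, two for every i < n, implies L₀ ⊓ ∃σ.Mᵢ; a goal name is equivalent
to the conjunction of L₀ and all ∃σ.Mᵢ. Since L₀ alone yields every binary path of length n, σ shows
only in inclusions that contain σ along some path: any other inclusion entailed by one target is
entailed by all (`satisfies_of_entails`, by way of the canonical model). A concept has no more paths
than its size, so an inclusion that is not common to all targets is entailed by at most |α| of the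
2ⁿ targets (`ncard_entails_le`).

Every selection of one choice name per index implies the goal name, whatever σ is. Without knowledge
of σ these 2ⁿ consequences have no short axiomatisation: a TBox of size below 2ⁿ differs from the
common consequences already on an inclusion of size at most 4n + 7 (`exists_small_difference`).

The adversary therefore answers as if the target were the set of common consequences. A negative
membership answer eliminates few targets. An equivalence query receives a small difference; a
missing common consequence eliminates no target, a superfluous inclusion only the few targets
entailing it. A polynomial budget leaves two targets that the learner cannot tell apart
(`not_identifies_of_family`). The targets are acyclic and the hypotheses arbitrary, so one family
serves all three claims. -/

/-! ### Adversaries for learners -/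

namespace LearningFramework

variable {F : LearningFramework}

/-- The exchanges of a learner with arbitrary answering functions in place of an oracle. -/
def simulate (A : F.Learner) (m : F.X → Bool) (e : F.L → Option F.X) : ℕ → List F.Exchange
  | 0 => []
  | k + 1 =>
    match A (simulate A m e k) with
    | Action.askMem x => Exchange.mem x (m x) :: simulate A m e k
    | Action.askEquiv h => Exchange.equiv h (e h) :: simulate A m e k
    | Action.halt _ => simulate A m e k

lemma transcript_eq_of_halt (A : F.Learner) {l : F.L} (O : F.Oracle l) {k : ℕ} {h : F.L}
    (hk : A (transcript A O k) = Action.halt h) {k' : ℕ} (hkk : k ≤ k') :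
    transcript A O k' = transcript A O k := by
  induction k', hkk using Nat.le_induction with
  | base => rfl
  | succ j _ ih => simp only [transcript]; rw [ih, hk]

lemma maxCexSize_le {t : List F.Exchange} {q : ℕ} (h : ∀ x ∈ t, x.cexSize ≤ q) :
    maxCexSize t ≤ q := by
  induction t with
  | nil => simp [maxCexSize]
  | cons a t ih =>
    have h1 := h a (by simp)
    have h2 := ih fun x hx => h x (by simp [hx])
    simp only [maxCexSize, List.map_cons, List.foldr_cons] at h2 ⊢
    exact max_le h1 h2

lemma queryCost_cons (x : F.Exchange) (t : List F.Exchange) :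
    queryCost (x :: t) = x.inputSize + queryCost t := by
  simp [queryCost]

section Adversary

variable {ι : Type} (T : ι → F.L) (cex : F.L → Option F.X)

/-- The exchange tells the target `T i` apart from an adversary that answers membership queries
by whether all targets contain the example and equivalence queries by `cex`. -/
def Excludes (i : ι) : F.Exchange → Prop
  | Exchange.mem x _ => ¬ (∀ j, x ∈ F.μ (T j)) ∧ x ∈ F.μ (T i)
  | Exchange.equiv h _ => ¬ ∃ x, cex h = some x ∧ x ∈ symmDiff (F.μ h) (F.μ (T i))

open Classical in
/-- The exchanges of a learner with the adversary that is independent of the target. -/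
noncomputable def adversaryRun (A : F.Learner) : ℕ → List F.Exchange :=
  simulate A (fun x => decide (∀ j, x ∈ F.μ (T j))) cex

variable {T cex}

lemma adversaryRun_subset (A : F.Learner) (k : ℕ) :
    ∀ x ∈ adversaryRun T cex A k, x ∈ adversaryRun T cex A (k + 1) := by
  intro x hx
  simp only [adversaryRun, simulate] at hx ⊢
  split <;> simp [hx]

/-- While no exchange excludes the target, the adversary's answers are correct for it: a refused
example lies outside it, and the proposed counterexample is valid. -/
lemma transcript_eq_adversaryRun (A : F.Learner) (i : ι) (O : F.Oracle (T i))
    (hO : ∀ h y, cex h = some y → y ∈ symmDiff (F.μ h) (F.μ (T i)) → O.equiv h = some y)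
    (k : ℕ) (hk : ∀ x ∈ adversaryRun T cex A k, ¬ Excludes T cex i x) :
    transcript A O k = adversaryRun T cex A k := by
  classical
  induction k with
  | zero => rfl
  | succ k ih =>
    have ih := ih fun x hx => hk x (adversaryRun_subset A k x hx)
    simp only [adversaryRun, simulate, transcript] at hk ih ⊢
    rw [ih]
    rcases hact : A (simulate A (fun x => decide (∀ j, x ∈ F.μ (T j))) cex k) with x | h | l <;>
      simp only [hact] at hk ⊢
    · have := hk _ (List.mem_cons_self)
      simp only [Excludes, not_and] at this
      congr 2
      rw [Bool.eq_iff_iff, O.mem_iff]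
      simp only [decide_eq_true_eq]
      exact ⟨fun h => by by_contra h'; exact this h' h, fun h => h i⟩
    · have := hk _ (List.mem_cons_self)
      simp only [Excludes, not_not] at this
      obtain ⟨x, hx, hx'⟩ := this
      rw [hO h x hx hx', hx]

/-- There is an oracle that prefers the counterexamples given by `cex`, and small ones otherwise. -/
lemma exists_oracle (i : ι) (q : ℕ) (hq : ∀ h x, cex h = some x → F.sizeX x ≤ q) :
    ∃ O : F.Oracle (T i),
      (∀ h y, cex h = some y → y ∈ symmDiff (F.μ h) (F.μ (T i)) → O.equiv h = some y) ∧
      (∀ h y, y ∈ symmDiff (F.μ h) (F.μ (T i)) → F.sizeX y ≤ q →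
        ∃ x, O.equiv h = some x ∧ F.sizeX x ≤ q) := by
  classical
  have key : ∀ h, ∃ o : Option F.X,
      (F.μ h = F.μ (T i) → o = none) ∧
      (F.μ h ≠ F.μ (T i) → ∃ x ∈ symmDiff (F.μ h) (F.μ (T i)), o = some x) ∧
      (∀ y, cex h = some y → y ∈ symmDiff (F.μ h) (F.μ (T i)) → o = some y) ∧
      (∀ y, y ∈ symmDiff (F.μ h) (F.μ (T i)) → F.sizeX y ≤ q →
        ∃ x, o = some x ∧ F.sizeX x ≤ q) := by
    intro h
    by_cases h0 : F.μ h = F.μ (T i)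
    · refine ⟨none, fun _ => rfl, fun h1 => (h1 h0).elim, ?_, ?_⟩ <;> simp [h0]
    by_cases h1 : ∃ x, cex h = some x ∧ x ∈ symmDiff (F.μ h) (F.μ (T i))
    · obtain ⟨x, hx, hx'⟩ := h1
      refine ⟨some x, fun h => (h0 h).elim, fun _ => ⟨x, hx', rfl⟩, ?_,
        fun _ _ _ => ⟨x, rfl, hq h x hx⟩⟩
      intro y hy _
      rw [← hx, hy]
    by_cases h2 : ∃ x ∈ symmDiff (F.μ h) (F.μ (T i)), F.sizeX x ≤ q
    · obtain ⟨x, hx, hx'⟩ := h2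
      exact ⟨some x, fun h => (h0 h).elim, fun _ => ⟨x, hx, rfl⟩,
        fun y hy hy' => (h1 ⟨y, hy, hy'⟩).elim, fun _ _ _ => ⟨x, rfl, hx'⟩⟩
    · have : (symmDiff (F.μ h) (F.μ (T i))).Nonempty := by
        rw [Set.nonempty_iff_ne_empty, ← Set.bot_eq_empty, Ne, symmDiff_eq_bot]
        exact h0
      obtain ⟨x, hx⟩ := this
      exact ⟨some x, fun h => (h0 h).elim, fun _ => ⟨x, hx, rfl⟩,
        fun y hy hy' => (h1 ⟨y, hy, hy'⟩).elim, fun y hy hy' => (h2 ⟨y, hy, hy'⟩).elim⟩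
  choose e h1 h2 h3 h4 using key
  exact ⟨⟨fun x => decide (x ∈ F.μ (T i)), e, by simp, h1, h2⟩, h3, h4⟩

variable [Fintype ι]

open Classical in
-- Exclusions are charged to the cost of queries. A membership query excludes at most as many
-- targets as the size of its example. An equivalence query excludes some only if its counterexample
-- lies in the hypothesis without being common, and then at most `q` targets.
lemma card_excluded_le {q K : ℕ}
    (hM : ∀ x, ¬ (∀ j, x ∈ F.μ (T j)) →
      (Finset.univ.filter fun i => x ∈ F.μ (T i)).card ≤ F.sizeX x)
    (hcex : ∀ h, F.sizeL h < K → ∃ x, cex h = some x ∧ F.sizeX x ≤ q ∧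
      ¬ (x ∈ F.μ h ↔ ∀ j, x ∈ F.μ (T j)))
    (hzero : ∀ h, F.sizeL h = 0 → ∀ x ∈ F.μ h, ∀ j, x ∈ F.μ (T j))
    (t : List F.Exchange) (ht : queryCost t < K) :
    (Finset.univ.filter fun i => ∃ x ∈ t, Excludes T cex i x).card ≤ queryCost t * (q + 1) := by
  induction t with
  | nil => simp
  | cons a t ih =>
    rw [queryCost_cons] at ht ⊢
    have ih := ih (by omega)
    have hle : (Finset.univ.filter fun i => Excludes T cex i a).card ≤ a.inputSize * (q + 1) := by
      cases a with
      | mem x b =>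
        simp only [Excludes, Exchange.inputSize]
        by_cases hx : ∀ j, x ∈ F.μ (T j)
        · simp [hx]
        · simp only [hx, not_false_eq_true, true_and]
          exact (hM x hx).trans (Nat.le_mul_of_pos_right _ (by omega))
      | equiv h o =>
        simp only [Exchange.inputSize] at ht ⊢
        obtain ⟨x, hx, hxq, hne⟩ := hcex h (by omega)
        have hE : ∀ i, Excludes T cex i (Exchange.equiv h o) →
            (x ∈ F.μ h ↔ x ∈ F.μ (T i)) := by
          intro i hi
          simp only [Excludes, hx, Option.some.injEq, exists_eq_left', Set.mem_symmDiff] at hi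
          tauto
        by_cases hc : ∀ j, x ∈ F.μ (T j)
        · have hxh : x ∉ F.μ h := fun hh => hne ⟨fun _ => hc, fun _ => hh⟩
          rw [Finset.filter_eq_empty_iff.2]
          · simp
          · intro i _ hi
            exact hxh ((hE i hi).2 (hc i))
        · have hxh : x ∈ F.μ h := by
            by_contra hh
            exact hne ⟨fun h' => (hh h').elim, fun h' => (hc h').elim⟩
          -- A hypothesis of size 0 costs nothing and so must exclude nothing.
          have hpos : 0 < F.sizeL h := by
            by_contra h0
            exact hc (hzero h (by omega) x hxh)
          calc _ ≤ (Finset.univ.filter fun i => x ∈ F.μ (T i)).card := by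
                apply Finset.card_le_card
                intro i hi
                simp only [Finset.mem_filter, Finset.mem_univ, true_and] at hi ⊢
                exact (hE i hi).1 hxh
            _ ≤ F.sizeX x := hM x hc
            _ ≤ q + 1 := by omega
            _ ≤ _ := Nat.le_mul_of_pos_left _ hpos
    calc _ ≤ ((Finset.univ.filter fun i => Excludes T cex i a) ∪
          (Finset.univ.filter fun i => ∃ x ∈ t, Excludes T cex i x)).card := by
          apply Finset.card_le_card
          intro i hi
          simpa using hi
      _ ≤ _ := (Finset.card_union_le _ _).trans (by rw [add_mul]; exact add_le_add hle ih)

/-- A learner cannot identify all members of a large family of targets within a fixed query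
budget `P` if single queries carry little information. -/
theorem not_identifies_of_family (A : F.Learner) (p : MvPolynomial (Fin 2) ℕ) {q K P : ℕ}
    (hsep : ∀ i j, i ≠ j → ∃ x ∈ symmDiff (F.μ (T i)) (F.μ (T j)), F.sizeX x ≤ q)
    (hM : ∀ x, ¬ (∀ j, x ∈ F.μ (T j)) → {i | x ∈ F.μ (T i)}.ncard ≤ F.sizeX x)
    (hE : ∀ h, F.sizeL h < K → ∃ x, F.sizeX x ≤ q ∧ ¬ (x ∈ F.μ h ↔ ∀ j, x ∈ F.μ (T j)))
    (hzero : ∀ h, F.sizeL h = 0 → ∀ x ∈ F.μ h, ∀ j, x ∈ F.μ (T j))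
    (hP : ∀ i, ∀ y ≤ q, MvPolynomial.eval ![F.sizeL (T i), y] p ≤ P)
    (hPK : P < K) (hcard : P * (q + 1) + 2 ≤ Fintype.card ι)
    (hId : ∀ i, Identifies A (T i)) (hB : ∀ i, QueryBounded p A (T i)) : False := by
  classical
  have hcex : ∃ cex : F.L → Option F.X,
      (∀ h, F.sizeL h < K → ∃ x, cex h = some x ∧ F.sizeX x ≤ q ∧
        ¬ (x ∈ F.μ h ↔ ∀ j, x ∈ F.μ (T j))) ∧ ∀ h x, cex h = some x → F.sizeX x ≤ q := by
    refine ⟨fun h => if hh : F.sizeL h < K then some (hE h hh).choose else none, ?_, ?_⟩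
    · intro h hh
      exact ⟨_, dif_pos hh, (hE h hh).choose_spec⟩
    · intro h x hx
      simp only at hx
      split at hx
      · next hh => cases hx; exact (hE h hh).choose_spec.1
      · simp at hx
  obtain ⟨cex, hcex, hq⟩ := hcex
  have hM' : ∀ x, ¬ (∀ j, x ∈ F.μ (T j)) →
      (Finset.univ.filter fun i => x ∈ F.μ (T i)).card ≤ F.sizeX x := by
    intro x hx
    have := hM x hx
    rwa [Set.ncard_eq_toFinset_card', Set.toFinset_ofPred] at this
  choose O hO1 hO2 using fun i => exists_oracle (T := T) (cex := cex) i q hq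
  set R := adversaryRun T cex A with hR
  -- Within the budget at most `P * (q + 1)` targets are excluded, so two survive.
  have two : ∀ k, queryCost (R k) ≤ P → ∃ i j, i ≠ j ∧
      transcript A (O i) k = R k ∧ transcript A (O j) k = R k := by
    intro k hk
    have h1 := card_excluded_le hM' hcex hzero (R k) (by omega)
    have h2 : queryCost (R k) * (q + 1) ≤ P * (q + 1) := Nat.mul_le_mul_right _ hk
    have h3 := Finset.card_filter_add_card_filter_not (s := (Finset.univ : Finset ι))
      (fun i => ∃ x ∈ R k, Excludes T cex i x)
    rw [Finset.card_univ] at h3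
    have h4 : 1 < (Finset.univ.filter fun i => ¬ ∃ x ∈ R k, Excludes T cex i x).card := by omega
    obtain ⟨i, hi, j, hj, hij⟩ := Finset.one_lt_card.1 h4
    simp only [Finset.mem_filter, Finset.mem_univ, true_and, not_exists, not_and] at hi hj
    exact ⟨i, j, hij, transcript_eq_adversaryRun A i _ (hO1 i) k hi,
      transcript_eq_adversaryRun A j _ (hO1 j) k hj⟩
  have hcexR : ∀ k, ∀ x ∈ R k, x.cexSize ≤ q := by
    intro k
    induction k with
    | zero => simp [hR, adversaryRun, simulate]
    | succ k ih =>
      intro x hx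
      simp only [hR, adversaryRun, simulate] at hx ih
      split at hx
      · rcases List.mem_cons.1 hx with rfl | hx
        · simp [Exchange.cexSize]
        · exact ih x hx
      · next h _ =>
        rcases List.mem_cons.1 hx with rfl | hx
        · cases hh : cex h with
          | none => simp [Exchange.cexSize]
          | some y => simpa [Exchange.cexSize] using hq h y hh
        · exact ih x hx
      · exact ih x hx
  -- The bound `p` at step `k + 1` already counts the answer to the current query, so it helps only
  -- with a target whose oracle answers with a small counterexample. The cost itself does not depend
  -- on that answer.
  have step : ∀ k i, transcript A (O i) k = R k →
      (∀ h, A (R k) = Action.askEquiv h →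
        ∃ y ∈ symmDiff (F.μ h) (F.μ (T i)), F.sizeX y ≤ q) →
      queryCost (R (k + 1)) ≤ P := by
    intro k i hi hy
    have hcost : queryCost (R (k + 1)) = queryCost (transcript A (O i) (k + 1)) := by
      rcases hact : A (R k) <;>
        simp only [hR, adversaryRun, simulate, transcript] at hi hact ⊢ <;>
        simp only [hi, hact, queryCost_cons, Exchange.inputSize]
    have hsz : maxCexSize (transcript A (O i) (k + 1)) ≤ q := by
      apply maxCexSize_le
      intro x hx
      simp only [transcript] at hx
      rw [hi] at hx
      split at hx
      · rcases List.mem_cons.1 hx with rfl | hx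
        · simp [Exchange.cexSize]
        · exact hcexR k x hx
      · next h hh =>
        rcases List.mem_cons.1 hx with rfl | hx
        · obtain ⟨y, hy1, hy2⟩ := hy h hh
          obtain ⟨z, hz1, hz2⟩ := hO2 i h y hy1 hy2
          simpa [Exchange.cexSize, hz1] using hz2
        · exact hcexR k x hx
      · exact hcexR k x hx
    rw [hcost]
    exact (hB i (O i) (k + 1)).trans (hP i _ hsz)
  have budget : ∀ k, queryCost (R k) ≤ P := by
    intro k
    induction k with
    | zero => simp [hR, adversaryRun, simulate, queryCost]
    | succ k ih =>
      obtain ⟨i, j, hij, hi, hj⟩ := two k ih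
      -- No hypothesis agrees with both survivors on `x`, so `x` is a small counterexample for one
      -- of them. This needs no prior bound on the size of the hypothesis.
      obtain ⟨x, hx, hxq⟩ := hsep i j hij
      by_cases hh : ∃ h, A (R k) = Action.askEquiv h
      · obtain ⟨h, hh⟩ := hh
        by_cases hxi : x ∈ symmDiff (F.μ h) (F.μ (T i))
        · refine step k i hi fun h' hh' => ⟨x, ?_, hxq⟩
          rw [hh] at hh'
          cases hh'
          exact hxi
        · refine step k j hj fun h' hh' => ⟨x, ?_, hxq⟩
          rw [hh] at hh'
          cases hh'
          rw [Set.mem_symmDiff] at *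
          tauto
      · exact step k i hi fun h hh' => (hh ⟨h, hh'⟩).elim
  -- Once all runs have halted, two survivors with the same transcript have the same output.
  choose k h hk hh using fun i => hId i (O i)
  obtain ⟨i, j, hij, hi, hj⟩ := two (Finset.univ.sup k) (budget _)
  have e1 := transcript_eq_of_halt A (O i) (hk i) (Finset.le_sup (f := k) (Finset.mem_univ i))
  have e2 := transcript_eq_of_halt A (O j) (hk j) (Finset.le_sup (f := k) (Finset.mem_univ j))
  have e3 := hk i
  have e4 := hk j
  rw [← e1, hi] at e3
  rw [← e2, hj, e3] at e4
  obtain ⟨x, hx, -⟩ := hsep i j hij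
  rw [← hh i, ← hh j, Action.halt.inj e4, symmDiff_self] at hx
  exact hx

end Adversary

/-! ### Asymptotics: exponentially many targets against a polynomial budget -/

lemma eventually_eval_lt_two_pow (f : Polynomial ℕ) : ∀ᶠ n : ℕ in Filter.atTop,
    f.eval n < 2 ^ n := by
  have h : (fun n : ℕ => ((f.eval n : ℕ) : ℝ)) =o[Filter.atTop] fun n : ℕ => (2 : ℝ) ^ n := by
    induction f using Polynomial.induction_on' with
    | add p q hp hq => simpa using hp.add hq
    | monomial k a =>
      simpa using (isLittleO_pow_const_const_pow_of_one_lt (R := ℝ) k one_lt_two).const_mul_left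
        (a : ℝ)
  filter_upwards [h.def (c := 1 / 2) (by norm_num)] with n hn
  rw [Real.norm_of_nonneg (by positivity), Real.norm_of_nonneg (by positivity)] at hn
  have : ((f.eval n : ℕ) : ℝ) < (2 : ℝ) ^ n := by
    have : (0 : ℝ) < 2 ^ n := by positivity
    linarith
  exact_mod_cast this

lemma mvPolynomial_eval_mono (p : MvPolynomial (Fin 2) ℕ) {v w : Fin 2 → ℕ} (h : v ≤ w) :
    MvPolynomial.eval v p ≤ MvPolynomial.eval w p := by
  rw [MvPolynomial.eval_eq, MvPolynomial.eval_eq]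
  gcongr with d _ i _
  exact h i

/-- A sequence of families with `2 ^ n` targets of size polynomial in `n`, in which single queries
carry little information, refutes polynomial query learnability. -/
theorem not_polyQueryLearnableOn_of_families {K : Type} {known : F.L → K} {𝒯 : Set F.L}
    (s q : Polynomial ℕ) (N : ℕ)
    (H : ∀ n ≥ N, ∃ T : (Fin n → Fin 2) → F.L,
      (∀ i, T i ∈ 𝒯) ∧ (∀ i j, known (T i) = known (T j)) ∧ (∀ i, F.sizeL (T i) ≤ s.eval n) ∧
      (∀ i j, i ≠ j → ∃ x ∈ symmDiff (F.μ (T i)) (F.μ (T j)), F.sizeX x ≤ q.eval n) ∧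
      (∀ x, ¬ (∀ j, x ∈ F.μ (T j)) → {i | x ∈ F.μ (T i)}.ncard ≤ F.sizeX x) ∧
      (∀ h, F.sizeL h < 2 ^ n →
        ∃ x, F.sizeX x ≤ q.eval n ∧ ¬ (x ∈ F.μ h ↔ ∀ j, x ∈ F.μ (T j))) ∧
      (∀ h, F.sizeL h = 0 → ∀ x ∈ F.μ h, ∀ j, x ∈ F.μ (T j))) :
    ¬ F.PolyQueryLearnableOn known 𝒯 := by
  rintro ⟨A, p, hA⟩
  set f : Polynomial ℕ := MvPolynomial.aeval ![s, q] p with hf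
  have hfe : ∀ n : ℕ, f.eval n = MvPolynomial.eval ![s.eval n, q.eval n] p := by
    intro n
    rw [hf, ← Polynomial.coe_evalRingHom, MvPolynomial.aeval_def, MvPolynomial.hom_eval₂,
      MvPolynomial.eval]
    congr 1
    · exact Subsingleton.elim _ _
    · funext i
      fin_cases i <;> rfl
  -- The first inequality keeps affordable hypotheses below size `2 ^ n`; the second leaves two of
  -- the `2 ^ n` targets.
  obtain ⟨n, hn, hn1, hn2⟩ := ((Filter.eventually_ge_atTop N).and
    ((eventually_eval_lt_two_pow f).and
      (eventually_eval_lt_two_pow (f * (q + 1) + 2)))).exists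
  obtain ⟨T, h1, h2, h3, h4, h5, h6, h7⟩ := H n hn
  simp only [Polynomial.eval_add, Polynomial.eval_mul, Polynomial.eval_one,
    Polynomial.eval_ofNat] at hn2
  have i0 : Fin n → Fin 2 := fun _ => 0
  refine not_identifies_of_family (T := T) (A (known (T i0))) p h4 h5 h6 h7
    (P := f.eval n) ?_ hn1 ?_ ?_ ?_
  · intro i y hy
    rw [hfe]
    apply mvPolynomial_eval_mono
    intro k
    fin_cases k
    · exact h3 i
    · exact hy
  · simpa using hn2.le
  · intro i
    rw [h2 i0 i]
    exact (hA _ (h1 i)).1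
  · intro i
    rw [h2 i0 i]
    exact (hA _ (h1 i)).2

end LearningFramework

namespace EL

open EL.Concept

/-! ### Paths and conjuncts of concepts -/

namespace Concept

/-- The role words along the paths that start at the root of a concept. -/
def paths : Concept → Finset (List ℕ)
  | top => {[]}
  | atom _ => {[]}
  | inter C D => C.paths ∪ D.paths
  | ex r C => {[]} ∪ C.paths.image (List.cons r)

lemma card_paths_le (C : Concept) : C.paths.card ≤ C.size := by
  induction C with
  | top => simp [paths, size]
  | atom => simp [paths, size]
  | inter C D hC hD =>
    have := Finset.card_union_le C.paths D.paths
    simp only [paths, size]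
    omega
  | ex r C hC =>
    have h1 := Finset.card_union_le {[]} (C.paths.image (List.cons r))
    have h2 := Finset.card_image_le (s := C.paths) (f := List.cons r)
    simp only [paths, size, Finset.card_singleton] at h1 ⊢
    omega

lemma nil_mem_paths (C : Concept) : [] ∈ C.paths := by
  induction C <;> simp_all [paths]

/-- No path in the concept is labelled with the word `σ`. -/
def Avoids (σ : List ℕ) (C : Concept) : Prop := ∀ u, u ++ σ ∉ C.paths

lemma Avoids.of_ex {σ : List ℕ} {r : ℕ} {C : Concept} (h : Avoids σ (ex r C)) : Avoids σ C :=
  fun u hu => h (r :: u) (by simp [paths, hu])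

lemma Avoids.left {σ : List ℕ} {C D : Concept} (h : Avoids σ (inter C D)) : Avoids σ C :=
  fun u hu => h u (by simp [paths, hu])

lemma Avoids.right {σ : List ℕ} {C D : Concept} (h : Avoids σ (inter C D)) : Avoids σ D :=
  fun u hu => h u (by simp [paths, hu])

/-- A path ends with at most one word of length `n`, its last `n` letters, so distinct words need
distinct paths. -/
lemma ncard_not_avoids_le {ι : Type} [Finite ι] {w : ι → List ℕ} (hw : Function.Injective w)
    {n : ℕ} (hn : ∀ i, (w i).length = n) (C : Concept) :
    {i | ¬ Avoids (w i) C}.ncard ≤ C.size := by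
  have h : w '' {i | ¬ Avoids (w i) C} ⊆
      ((C.paths.image fun p => p.drop (p.length - n) : Finset (List ℕ)) : Set (List ℕ)) := by
    rintro _ ⟨i, hi, rfl⟩
    simp only [Avoids, not_forall, not_not, Set.mem_ofPred_eq] at hi
    obtain ⟨u, hu⟩ := hi
    simp only [Finset.coe_image, Set.mem_image, Finset.mem_coe]
    exact ⟨_, hu, by simp [hn i]⟩
  rw [← Set.ncard_image_of_injective _ hw]
  refine (Set.ncard_le_ncard h (Finset.finite_toSet _)).trans ?_
  rw [Set.ncard_coe_finset]
  exact Finset.card_image_le.trans C.card_paths_le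

/-- The top-level conjuncts of a concept. -/
def conjuncts : Concept → Set Concept
  | inter C D => C.conjuncts ∪ D.conjuncts
  | top => {top}
  | atom A => {atom A}
  | ex r C => {ex r C}

lemma cons_mem_paths {r : ℕ} {w : List ℕ} {E F : Concept} (h : ex r F ∈ E.conjuncts)
    (hw : w ∈ F.paths) : r :: w ∈ E.paths := by
  induction E with
  | inter C D hC hD => rcases h with h | h <;> simp [paths, hC, hD, h]
  | ex s C => cases h; simp [paths, hw]
  | _ => cases h

lemma Avoids.of_mem_conjuncts {σ : List ℕ} {r : ℕ} {E F : Concept} (h : Avoids σ E)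
    (hF : ex r F ∈ E.conjuncts) : Avoids σ F :=
  fun u hu => h (r :: u) (cons_mem_paths hF hu)

/-- The concept `∃w.C` for a role word `w`. -/
def exWord (w : List ℕ) (C : Concept) : Concept := w.foldr ex C

@[simp] lemma exWord_nil (C : Concept) : exWord [] C = C := rfl

@[simp] lemma exWord_cons (r : ℕ) (w : List ℕ) (C : Concept) :
    exWord (r :: w) C = ex r (exWord w C) := rfl

lemma size_exWord (w : List ℕ) (C : Concept) : (exWord w C).size = 2 * w.length + C.size := by
  induction w with
  | nil => simp
  | cons r w ih => simp only [exWord_cons, size, ih, List.length_cons]; ring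

lemma conceptNames_exWord (w : List ℕ) (C : Concept) :
    (exWord w C).conceptNames = C.conceptNames := by
  induction w with
  | nil => rfl
  | cons r w ih => simpa [conceptNames] using ih

lemma roleNames_exWord_atom (w : List ℕ) (A : ℕ) :
    (exWord w (atom A)).roleNames = w.toFinset := by
  induction w with
  | nil => rfl
  | cons r w ih => rw [exWord_cons, roleNames, ih, List.toFinset_cons, Finset.insert_eq]

lemma mem_paths_exWord_atom {w v : List ℕ} {A : ℕ} (h : v ∈ (exWord w (atom A)).paths) :
    v <+: w := by
  induction w generalizing v with
  | nil => simp_all [paths]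
  | cons r w ih =>
    simp only [exWord_cons, paths, Finset.mem_union, Finset.mem_singleton, Finset.mem_image] at h
    rcases h with rfl | ⟨u, hu, rfl⟩
    · simp
    · simpa using ih hu

lemma avoids_exWord_atom {σ w : List ℕ} {A : ℕ} (h : w.length < σ.length) :
    Avoids σ (exWord w (atom A)) := by
  intro u hu
  have := (mem_paths_exWord_atom hu).length_le
  simp at this
  omega

/-- The conjunction of a list of concepts. -/
def conj (l : List Concept) : Concept := l.foldr inter top

lemma conceptNames_conj (l : List Concept) (B : ℕ) :
    B ∈ (conj l).conceptNames ↔ ∃ C ∈ l, B ∈ C.conceptNames := by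
  induction l with
  | nil => simp [conj, conceptNames]
  | cons C l ih => simp_all [conj, conceptNames]

lemma roleNames_conj (l : List Concept) (r : ℕ) :
    r ∈ (conj l).roleNames ↔ ∃ C ∈ l, r ∈ C.roleNames := by
  induction l with
  | nil => simp [conj, roleNames]
  | cons C l ih => simp_all [conj, roleNames]

lemma size_conj_le {l : List Concept} {b : ℕ} (h : ∀ C ∈ l, C.size ≤ b) :
    (conj l).size ≤ l.length * (b + 1) + 1 := by
  induction l with
  | nil => simp [conj, size]
  | cons C l ih =>
    have h1 := h C (by simp)
    have h2 := ih fun D hD => h D (by simp [hD])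
    simp only [conj, List.foldr_cons, size, List.length_cons] at h2 ⊢
    rw [add_mul]
    omega

end Concept

namespace Interpretation

variable (I : Interpretation)

lemma mem_ext_conj (l : List Concept) (d : I.Dom) :
    d ∈ I.ext (conj l) ↔ ∀ C ∈ l, d ∈ I.ext C := by
  induction l with
  | nil => simp [conj, ext]
  | cons C l ih => simp_all [conj, ext]

lemma mem_ext_of_mem_conjuncts {E F : Concept} (hF : F ∈ E.conjuncts) {d : I.Dom}
    (hd : d ∈ I.ext E) : d ∈ I.ext F := by
  induction E with
  | inter C D hC hD =>
    rcases hF with h | h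
    · exact hC h hd.1
    · exact hD h hd.2
  | _ => cases hF; exact hd

end Interpretation

/-! ### The targets -/

/-- The defined concept name. -/
def goalName : ℕ := 0

/-- The concept name for level `j` of the binary tree. -/
def levelName (j : ℕ) : ℕ := 4 * j + 1

/-- The `i`-th marker of the end of the hidden word. -/
def markName (i : ℕ) : ℕ := 4 * i + 2

/-- The two concept names that imply the existence of the `i`-th marker. -/
def choiceName (b : Bool) (i : ℕ) : ℕ := 4 * i + 3 + b.toNat

/-- The definition of the level `j`. -/
def levelDef (j : ℕ) : TermDef :=
  .sub (levelName j)
    (inter (ex 0 (atom (levelName (j + 1)))) (ex 1 (atom (levelName (j + 1)))))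

/-- The definition of a choice name, for the hidden word `σ`. -/
def choiceDef (σ : List ℕ) (b : Bool) (i : ℕ) : TermDef :=
  .sub (choiceName b i) (inter (atom (levelName 0)) (exWord σ (atom (markName i))))

/-- The right-hand side of the definition of `goalName`. -/
def goalConcept (n : ℕ) (σ : List ℕ) : Concept :=
  inter (atom (levelName 0)) (conj ((List.range n).map fun i => exWord σ (atom (markName i))))

/-- The definition of `goalName`. -/
def goalDef (n : ℕ) (σ : List ℕ) : TermDef := .equiv goalName (goalConcept n σ)

open Classical in
/-- The definitions in the acyclic TBox with the hidden word `σ`. -/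
noncomputable def hiddenDefs (n : ℕ) (σ : List ℕ) : Finset TermDef :=
  (((List.range n).map levelDef) ++ ((List.range n).map (choiceDef σ false)) ++
    ((List.range n).map (choiceDef σ true)) ++ [goalDef n σ]).toFinset

open Classical in
/-- The concept inclusions that a definition stands for. -/
noncomputable def TermDef.cis : TermDef → TBox
  | .sub A C => {⟨atom A, C⟩}
  | .equiv A C => {⟨atom A, C⟩, ⟨C, atom A⟩}

lemma TermDef.mem_cis {δ : TermDef} {α : CI} : α ∈ δ.cis ↔ α ∈ δ.inclusions := by
  cases δ <;> simp [cis, inclusions]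

open Classical in
/-- The TBox with the hidden word `σ`. -/
noncomputable def hiddenTBox (n : ℕ) (σ : List ℕ) : TBox := (hiddenDefs n σ).biUnion TermDef.cis

lemma mem_hiddenTBox {n : ℕ} {σ : List ℕ} {α : CI} :
    α ∈ hiddenTBox n σ ↔ ∃ δ ∈ hiddenDefs n σ, α ∈ δ.inclusions := by
  simp [hiddenTBox, TermDef.mem_cis]

lemma mem_hiddenDefs {n : ℕ} {σ : List ℕ} {δ : TermDef} :
    δ ∈ hiddenDefs n σ ↔ (∃ j < n, δ = levelDef j) ∨ (∃ i < n, ∃ b, δ = choiceDef σ b i) ∨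
      δ = goalDef n σ := by
  simp only [hiddenDefs, List.mem_toFinset, List.mem_append, List.mem_map, List.mem_range,
    List.mem_singleton, Bool.exists_bool]
  constructor
  · rintro (((⟨j, hj, rfl⟩ | ⟨j, hj, rfl⟩) | ⟨j, hj, rfl⟩) | rfl)
    · exact .inl ⟨j, hj, rfl⟩
    · exact .inr (.inl ⟨j, hj, .inl rfl⟩)
    · exact .inr (.inl ⟨j, hj, .inr rfl⟩)
    · exact .inr (.inr rfl)
  · rintro (⟨j, hj, rfl⟩ | ⟨j, hj, rfl | rfl⟩ | rfl)
    · exact .inl (.inl (.inl ⟨j, hj, rfl⟩))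
    · exact .inl (.inl (.inr ⟨j, hj, rfl⟩))
    · exact .inl (.inr ⟨j, hj, rfl⟩)
    · exact .inr rfl

lemma mem_conceptNames_goalConcept {n : ℕ} {σ : List ℕ} {B : ℕ} :
    B ∈ (goalConcept n σ).conceptNames ↔ B = levelName 0 ∨ ∃ i < n, B = markName i := by
  simp [goalConcept, conceptNames, conceptNames_conj, conceptNames_exWord]

/-! ### Acyclicity, size and signature of the targets -/

/-- A rank that decreases along the definitions. -/
def nameRank (n B : ℕ) : ℕ :=
  if B = 0 then n + 3 else if B % 4 = 1 then n + 1 - B / 4 else if B % 4 = 2 then 0 else n + 2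

lemma nameRank_goalName (n : ℕ) : nameRank n goalName = n + 3 := rfl

lemma nameRank_levelName (n j : ℕ) : nameRank n (levelName j) = n + 1 - j := by
  unfold nameRank levelName
  rw [if_neg (by omega), if_pos (by omega)]
  omega

lemma nameRank_markName (n i : ℕ) : nameRank n (markName i) = 0 := by
  unfold nameRank markName
  rw [if_neg (by omega), if_neg (by omega), if_pos (by omega)]

lemma nameRank_choiceName (n : ℕ) (b : Bool) (i : ℕ) : nameRank n (choiceName b i) = n + 2 := by
  unfold nameRank choiceName
  cases b <;> simp only [Bool.toNat_true, Bool.toNat_false] <;>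
    rw [if_neg (by omega), if_neg (by omega), if_neg (by omega)]

lemma nameRank_lt {n : ℕ} {σ : List ℕ} {δ : TermDef} (hδ : δ ∈ hiddenDefs n σ) {B : ℕ}
    (hB : B ∈ δ.rhs.conceptNames) : nameRank n B < nameRank n δ.lhs := by
  rcases mem_hiddenDefs.1 hδ with ⟨j, hj, rfl⟩ | ⟨i, hi, b, rfl⟩ | rfl
  · simp only [levelDef, TermDef.rhs, conceptNames, Finset.union_self, Finset.mem_singleton] at hB
    subst hB
    simp only [levelDef, TermDef.lhs, nameRank_levelName]
    omega
  · simp only [choiceDef, TermDef.rhs, conceptNames, conceptNames_exWord, Finset.mem_union,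
      Finset.mem_singleton] at hB
    rcases hB with rfl | rfl <;>
      simp [choiceDef, TermDef.lhs, nameRank_levelName, nameRank_choiceName, nameRank_markName]
  · simp only [goalDef, TermDef.rhs, mem_conceptNames_goalConcept] at hB
    rcases hB with rfl | ⟨i, -, rfl⟩ <;>
      simp [goalDef, TermDef.lhs, nameRank_levelName, nameRank_goalName, nameRank_markName]

lemma acyclic_hiddenTBox (n : ℕ) (σ : List ℕ) : (hiddenTBox n σ).Acyclic := by
  refine ⟨hiddenDefs n σ, fun α => mem_hiddenTBox, ?_, ?_⟩
  · intro δ hδ δ' hδ' h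
    rcases mem_hiddenDefs.1 hδ with ⟨j, hj, rfl⟩ | ⟨i, hi, b, rfl⟩ | rfl <;>
    rcases mem_hiddenDefs.1 hδ' with ⟨j', hj', rfl⟩ | ⟨i', hi', b', rfl⟩ | rfl <;>
    simp only [levelDef, choiceDef, goalDef, TermDef.lhs, levelName, choiceName, goalName] at h
    · obtain rfl : j = j' := by omega
      rfl
    · cases b' <;> simp at h <;> omega
    · omega
    · cases b <;> simp at h <;> omega
    · cases b <;> cases b' <;> simp at h
      · rw [h]
      · omega
      · omega
      · rw [h]
    · omega
    · omega
    · omega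
    · rfl
  · intro A hA
    have key : ∀ B B', Relation.TransGen
        (fun B B' : ℕ => ∃ δ ∈ hiddenDefs n σ, δ.lhs = B ∧ B' ∈ δ.rhs.conceptNames) B B' →
        nameRank n B' < nameRank n B := by
      intro B B' h
      induction h with
      | single h =>
        obtain ⟨δ, hδ, rfl, hB⟩ := h
        exact nameRank_lt hδ hB
      | tail _ h ih =>
        obtain ⟨δ, hδ, rfl, hB⟩ := h
        exact (nameRank_lt hδ hB).trans ih
    exact (key A A hA).false

lemma size_goalConcept_le {n : ℕ} {σ : List ℕ} (hσ : σ.length = n) :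
    (goalConcept n σ).size ≤ 2 * n ^ 2 + 2 * n + 3 := by
  have := size_conj_le (l := (List.range n).map fun i => exWord σ (atom (markName i)))
    (b := 2 * n + 1) (by
      intro C hC
      simp only [List.mem_map, List.mem_range] at hC
      obtain ⟨i, -, rfl⟩ := hC
      simp [size_exWord, size, hσ])
  simp only [List.length_map, List.length_range] at this
  simp only [goalConcept, size]
  nlinarith

lemma size_hiddenTBox_le {n : ℕ} {σ : List ℕ} (hσ : σ.length = n) :
    (hiddenTBox n σ).size ≤ (3 * n + 1) * 2 * (2 * n ^ 2 + 2 * n + 8) := by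
  classical
  have hcard : (hiddenTBox n σ).card ≤ (3 * n + 1) * 2 := by
    refine Finset.card_biUnion_le_card_mul _ _ 2 ?_ |>.trans ?_
    · intro δ _
      cases δ
      · simp [TermDef.cis]
      · exact Finset.card_le_two
    · refine Nat.mul_le_mul_right 2 ((List.toFinset_card_le _).trans ?_)
      simp
      omega
  -- The 8 is the size of a level inclusion; the quadratic part comes from the goal definition.
  refine (Finset.sum_le_card_nsmul _ _ (2 * n ^ 2 + 2 * n + 8) ?_).trans
    (Nat.mul_le_mul_right _ hcard)
  intro α hα
  have hg := size_goalConcept_le hσ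
  obtain ⟨δ, hδ, hα⟩ := mem_hiddenTBox.1 hα
  rcases mem_hiddenDefs.1 hδ with ⟨j, hj, rfl⟩ | ⟨i, hi, b, rfl⟩ | rfl
  · cases hα
    simp [CI.size, size]
  · cases hα
    simp only [CI.size, size, size_exWord, hσ]
    nlinarith
  · rcases hα with rfl | rfl <;> simp only [CI.size, size] <;> omega

lemma sig_hiddenTBox_fst (n : ℕ) (σ τ : List ℕ) :
    (hiddenTBox n σ).sig.1 = (hiddenTBox n τ).sig.1 := by
  have key : ∀ σ τ : List ℕ, (hiddenTBox n σ).sig.1 ⊆ (hiddenTBox n τ).sig.1 := by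
    intro σ τ B hB
    simp only [TBox.sig, Finset.mem_biUnion] at hB ⊢
    obtain ⟨α, hα, hB⟩ := hB
    obtain ⟨δ, hδ, hα⟩ := mem_hiddenTBox.1 hα
    rcases mem_hiddenDefs.1 hδ with ⟨j, hj, rfl⟩ | ⟨i, hi, b, rfl⟩ | rfl
    · exact ⟨α, mem_hiddenTBox.2 ⟨_, mem_hiddenDefs.2 (.inl ⟨j, hj, rfl⟩), hα⟩, hB⟩
    · cases hα
      refine ⟨_, mem_hiddenTBox.2 ⟨_, mem_hiddenDefs.2 (.inr (.inl ⟨i, hi, b, rfl⟩)), rfl⟩, ?_⟩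
      simpa [conceptNames, conceptNames_exWord] using hB
    · refine ⟨_, mem_hiddenTBox.2 ⟨_, mem_hiddenDefs.2 (.inr (.inr rfl)), .inl rfl⟩, ?_⟩
      rcases hα with rfl | rfl <;>
        simp only [Finset.mem_union, mem_conceptNames_goalConcept] at hB ⊢ <;> tauto
  exact (key σ τ).antisymm (key τ σ)

/-- The known signature must not reveal the word. A level definition already uses both roles, and `1
≤ n` provides one. -/
lemma sig_hiddenTBox_snd {n : ℕ} (hn : 1 ≤ n) {σ : List ℕ} (hσ : ∀ r ∈ σ, r < 2) :
    (hiddenTBox n σ).sig.2 = {0, 1} := by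
  ext r
  simp only [TBox.sig, Finset.mem_biUnion]
  constructor
  · rintro ⟨α, hα, hr⟩
    obtain ⟨δ, hδ, hα⟩ := mem_hiddenTBox.1 hα
    have hrσ : r ∈ σ → r ∈ ({0, 1} : Finset ℕ) := by
      intro h
      have := hσ r h
      interval_cases r <;> simp
    rcases mem_hiddenDefs.1 hδ with ⟨j, hj, rfl⟩ | ⟨i, hi, b, rfl⟩ | rfl
    · cases hα
      simpa [roleNames] using hr
    · cases hα
      apply hrσ
      simpa [roleNames, roleNames_exWord_atom] using hr
    · rcases hα with rfl | rfl <;>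
      · simp only [goalConcept, roleNames, Finset.mem_union, roleNames_conj, List.mem_map,
          exists_exists_and_eq_and, roleNames_exWord_atom] at hr
        apply hrσ
        simp at hr
        tauto
  · intro hr
    refine ⟨_, mem_hiddenTBox.2 ⟨_, mem_hiddenDefs.2 (.inl ⟨0, hn, rfl⟩), rfl⟩, ?_⟩
    simpa [roleNames] using hr

lemma isModel_hiddenTBox {n : ℕ} {σ : List ℕ} {I : Interpretation} :
    I.IsModel (hiddenTBox n σ) ↔
      (∀ j < n, ∀ d ∈ I.concept (levelName j), ∀ r < 2,
        d ∈ I.ext (ex r (atom (levelName (j + 1))))) ∧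
      (∀ i < n, ∀ b, ∀ d ∈ I.concept (choiceName b i),
        d ∈ I.concept (levelName 0) ∧ d ∈ I.ext (exWord σ (atom (markName i)))) ∧
      (∀ d, d ∈ I.concept goalName ↔ d ∈ I.concept (levelName 0) ∧
        ∀ i < n, d ∈ I.ext (exWord σ (atom (markName i)))) := by
  have hg : ∀ d, d ∈ I.ext (goalConcept n σ) ↔ d ∈ I.concept (levelName 0) ∧
      ∀ i < n, d ∈ I.ext (exWord σ (atom (markName i))) := by
    intro d
    simp only [goalConcept, Interpretation.ext, Set.mem_inter_iff, Interpretation.mem_ext_conj]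
    simp
  constructor
  · intro h
    have h' : ∀ δ ∈ hiddenDefs n σ, ∀ α ∈ δ.inclusions, I.Satisfies α :=
      fun δ hδ α hα => h α (mem_hiddenTBox.2 ⟨δ, hδ, hα⟩)
    refine ⟨?_, ?_, ?_⟩
    · intro j hj d hd r hr
      have := h' _ (mem_hiddenDefs.2 (.inl ⟨j, hj, rfl⟩)) _ rfl hd
      interval_cases r
      · exact this.1
      · exact this.2
    · intro i hi b d hd
      exact h' _ (mem_hiddenDefs.2 (.inr (.inl ⟨i, hi, b, rfl⟩))) _ rfl hd
    · intro d
      rw [← hg]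
      exact ⟨fun hd => h' _ (mem_hiddenDefs.2 (.inr (.inr rfl))) _ (.inl rfl) hd,
        fun hd => h' _ (mem_hiddenDefs.2 (.inr (.inr rfl))) _ (.inr rfl) hd⟩
  · rintro ⟨h1, h2, h3⟩ α hα
    obtain ⟨δ, hδ, hα⟩ := mem_hiddenTBox.1 hα
    rcases mem_hiddenDefs.1 hδ with ⟨j, hj, rfl⟩ | ⟨i, hi, b, rfl⟩ | rfl
    · cases hα
      exact fun d hd => ⟨h1 j hj d hd 0 (by omega), h1 j hj d hd 1 (by omega)⟩
    · cases hα
      exact fun d hd => h2 i hi b d hd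
    · rcases hα with rfl | rfl
      · exact fun d hd => (hg d).2 ((h3 d).1 hd)
      · exact fun d hd => (h3 d).2 ((hg d).1 hd)

/-! ### The common consequences of the targets -/

/-- The element `d` satisfies a concept name that implies the `i`-th marker. -/
def Triggers (I : Interpretation) (i : ℕ) (d : I.Dom) : Prop :=
  d ∈ I.concept goalName ∨ ∃ b, d ∈ I.concept (choiceName b i)

/-- The interpretation satisfies the binary tree axioms. -/
def IsTreeModel (n : ℕ) (I : Interpretation) : Prop :=
  ∀ j < n, ∀ d ∈ I.concept (levelName j), ∀ r < 2, d ∈ I.ext (ex r (atom (levelName (j + 1))))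

/-- The interpretation satisfies the consequences that do not depend on the hidden word. -/
def IsCommonModel (n : ℕ) (I : Interpretation) : Prop :=
  IsTreeModel n I ∧ (∀ i < n, ∀ d, Triggers I i d → d ∈ I.concept (levelName 0)) ∧
    ∀ d, (∀ i < n, Triggers I i d) → d ∈ I.concept goalName

lemma IsCommonModel.of_isModel {n : ℕ} (hn : 1 ≤ n) {σ : List ℕ} {I : Interpretation}
    (h : I.IsModel (hiddenTBox n σ)) : IsCommonModel n I := by
  obtain ⟨h1, h2, h3⟩ := isModel_hiddenTBox.1 h
  refine ⟨h1, ?_, ?_⟩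
  · rintro i hi d (hd | ⟨b, hd⟩)
    · exact ((h3 d).1 hd).1
    · exact (h2 i hi b d hd).1
  · intro d hd
    by_cases hg : d ∈ I.concept goalName
    · exact hg
    have hd' : ∀ i < n, ∃ b, d ∈ I.concept (choiceName b i) :=
      fun i hi => (hd i hi).resolve_left hg
    refine (h3 d).2 ⟨?_, fun i hi => ?_⟩
    · obtain ⟨b, hb⟩ := hd' 0 hn
      exact (h2 0 hn b d hb).1
    · obtain ⟨b, hb⟩ := hd' i hi
      exact (h2 i hi b d hb).2

/-! ### The canonical model of a target -/

/-- The concept has a top-level conjunct that implies the `i`-th marker. -/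
def ConceptTriggers (i : ℕ) (E : Concept) : Prop :=
  atom goalName ∈ E.conjuncts ∨ ∃ b, atom (choiceName b i) ∈ E.conjuncts

/-- The concept implies the level `j`. -/
def HasLevel (n : ℕ) (j : ℕ) (E : Concept) : Prop :=
  atom (levelName j) ∈ E.conjuncts ∨ j = 0 ∧ ∃ i < n, ConceptTriggers i E

/-- The edges of the canonical model. -/
def CanonEdge (n : ℕ) (σ : List ℕ) (r : ℕ) (E F : Concept) : Prop :=
  ex r F ∈ E.conjuncts ∨
  (∃ j < n, HasLevel n j E ∧ r < 2 ∧ F = atom (levelName (j + 1))) ∨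
  ∃ i < n, ConceptTriggers i E ∧ ∃ w, σ = r :: w ∧ F = exWord w (atom (markName i))

/-- The `i`-th marker can be reached along the word in the canonical model. -/
def MarkReach (n : ℕ) (σ : List ℕ) (i : ℕ) : List ℕ → Concept → Prop
  | [], E => atom (markName i) ∈ E.conjuncts
  | r :: w, E => ∃ F, CanonEdge n σ r E F ∧ MarkReach n σ i w F

/-- The canonical model of the TBox with the hidden word `σ`; its elements are all concepts. -/
def canon (n : ℕ) (σ : List ℕ) : Interpretation where
  Dom := Concept
  nonempty := ⟨top⟩
  concept B := {E | atom B ∈ E.conjuncts ∨ (B = levelName 0 ∧ HasLevel n 0 E) ∨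
    (B = goalName ∧ HasLevel n 0 E ∧ ∀ i < n, MarkReach n σ i σ E)}
  role r := {p | CanonEdge n σ r p.1 p.2}

/-- The `i`-th marker occurs explicitly in the concept, at the end of a path labelled with the
word. -/
def MarkAt (i : ℕ) : List ℕ → Concept → Prop
  | [], E => atom (markName i) ∈ E.conjuncts
  | r :: w, E => ∃ F, ex r F ∈ E.conjuncts ∧ MarkAt i w F

lemma MarkAt.mem_paths {i : ℕ} {w : List ℕ} {E : Concept} (h : MarkAt i w E) : w ∈ E.paths := by
  induction w generalizing E with
  | nil => exact nil_mem_paths E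
  | cons r w ih =>
    obtain ⟨F, hF, h⟩ := h
    exact cons_mem_paths hF (ih h)

lemma markAt_atom {i B : ℕ} {w : List ℕ} (h : MarkAt i w (atom B)) : w = [] ∧ B = markName i := by
  cases w with
  | nil => cases h; exact ⟨rfl, rfl⟩
  | cons r w => obtain ⟨F, hF, -⟩ := h; cases hF

lemma markName_injective : Function.Injective markName := by
  intro i j h
  simp only [markName] at h
  omega

lemma markAt_exWord {i j : ℕ} {w v : List ℕ} (h : MarkAt i w (exWord v (atom (markName j)))) :
    w = v ∧ i = j := by
  induction v generalizing w with
  | nil =>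
    obtain ⟨h1, h2⟩ := markAt_atom h
    exact ⟨h1, (markName_injective h2).symm⟩
  | cons s v ih =>
    cases w with
    | nil => cases h
    | cons r w =>
      obtain ⟨F, hF, h⟩ := h
      cases hF
      obtain ⟨rfl, rfl⟩ := ih h
      exact ⟨rfl, rfl⟩

section Canon

variable {n : ℕ} {σ : List ℕ}

/-- An edge into a level name leads to no explicit marker, and an edge into the hidden path leads to
one only if the rest of the word matches exactly. -/
lemma canonEdge_mark {i r : ℕ} {w : List ℕ} {E : Concept}
    (hw : ∀ F, MarkReach n σ i w F → MarkAt i w F) (h : MarkReach n σ i (r :: w) E) :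
    MarkAt i (r :: w) E ∨ σ = r :: w ∧ ConceptTriggers i E := by
  obtain ⟨F, hF | ⟨j, hj, hE, hr, rfl⟩ | ⟨i', hi', hE, v, hv, rfl⟩, h⟩ := h
  · exact .inl ⟨F, hF, hw F h⟩
  · have := (markAt_atom (hw _ h)).2
    simp only [levelName, markName] at this
    omega
  · obtain ⟨rfl, rfl⟩ := markAt_exWord (hw _ h)
    exact .inr ⟨hv, hE⟩

/-- The hidden path is entered only at its start and consumes all of `σ`, so shorter words reach
markers only along explicit edges. -/
lemma markAt_of_markReach {i : ℕ} {w : List ℕ} {E : Concept} (hlen : w.length < σ.length)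
    (h : MarkReach n σ i w E) : MarkAt i w E := by
  induction w generalizing E with
  | nil => exact h
  | cons r w ih =>
    have hlen' : w.length < σ.length := by simp at hlen; omega
    rcases canonEdge_mark (fun F => ih hlen') h with h | ⟨h, -⟩
    · exact h
    · rw [h] at hlen
      omega

lemma markAt_or_of_markReach {i : ℕ} {w : List ℕ} {E : Concept} (hw : w ≠ [])
    (hlen : w.length ≤ σ.length) (h : MarkReach n σ i w E) :
    MarkAt i w E ∨ σ = w ∧ ConceptTriggers i E := by
  cases w with
  | nil => exact (hw rfl).elim
  | cons r w =>
    have : w.length < σ.length := by simpa using hlen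
    exact canonEdge_mark (fun F => markAt_of_markReach this) h

lemma markReach_exWord (i : ℕ) (w : List ℕ) :
    MarkReach n σ i w (exWord w (atom (markName i))) := by
  induction w with
  | nil => exact rfl
  | cons r w ih => exact ⟨_, .inl rfl, ih⟩

lemma markReach_of_triggers (hσ : σ ≠ []) {i : ℕ} (hi : i < n) {E : Concept}
    (h : ConceptTriggers i E) : MarkReach n σ i σ E := by
  obtain ⟨r, w, rfl⟩ := List.exists_cons_of_ne_nil hσ
  exact ⟨_, .inr (.inr ⟨i, hi, h, w, rfl, rfl⟩), markReach_exWord i w⟩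

lemma mem_canon_markName {i : ℕ} {E : Concept} :
    E ∈ (canon n σ).concept (markName i) ↔ atom (markName i) ∈ E.conjuncts := by
  refine ⟨?_, .inl⟩
  rintro (h | ⟨h, -⟩ | ⟨h, -⟩)
  · exact h
  · simp only [markName, levelName] at h
    omega
  · simp only [markName, goalName] at h
    omega

lemma mem_canon_choiceName {b : Bool} {i : ℕ} {E : Concept} :
    E ∈ (canon n σ).concept (choiceName b i) ↔ atom (choiceName b i) ∈ E.conjuncts := by
  refine ⟨?_, .inl⟩
  rintro (h | ⟨h, -⟩ | ⟨h, -⟩)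
  · exact h
  · cases b <;> simp [choiceName, levelName] at h
  · simp [choiceName, goalName] at h

lemma mem_canon_levelName {j : ℕ} {E : Concept} :
    E ∈ (canon n σ).concept (levelName j) ↔ HasLevel n j E := by
  constructor
  · rintro (h | ⟨h, h'⟩ | ⟨h, -⟩)
    · exact .inl h
    · obtain rfl : j = 0 := by simp only [levelName] at h; omega
      exact h'
    · simp [levelName, goalName] at h
  · rintro (h | ⟨rfl, h⟩)
    · exact .inl h
    · exact .inr (.inl ⟨rfl, .inr ⟨rfl, h⟩⟩)

lemma mem_canon_exWord {i : ℕ} {w : List ℕ} {E : Concept} :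
    E ∈ (canon n σ).ext (exWord w (atom (markName i))) ↔ MarkReach n σ i w E := by
  induction w generalizing E with
  | nil => exact mem_canon_markName
  | cons r w ih =>
    constructor
    · rintro ⟨F, hF, h⟩
      exact ⟨F, h, ih.1 hF⟩
    · rintro ⟨F, h, hF⟩
      exact ⟨F, ih.2 hF, h⟩

/-- The point is that the element `E` satisfies the concept `E`; inclusion of conjuncts lets the
induction pass through conjunctions. -/
lemma mem_canon_of_conjuncts_subset {C E : Concept} (h : C.conjuncts ⊆ E.conjuncts) :
    E ∈ (canon n σ).ext C := by
  induction C generalizing E with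
  | top => trivial
  | atom B => exact .inl (h rfl)
  | inter C D hC hD =>
    exact ⟨hC (Set.subset_union_left.trans h), hD (Set.subset_union_right.trans h)⟩
  | ex r C hC => exact ⟨C, hC subset_rfl, .inl (h rfl)⟩

lemma isModel_canon (hn : 1 ≤ n) (hσ : σ.length = n) :
    (canon n σ).IsModel (hiddenTBox n σ) := by
  have hne : σ ≠ [] := by
    rintro rfl
    simp at hσ
    omega
  refine isModel_hiddenTBox.2 ⟨?_, ?_, ?_⟩
  · intro j hj E hE r hr
    exact ⟨_, mem_canon_of_conjuncts_subset subset_rfl,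
      .inr (.inl ⟨j, hj, mem_canon_levelName.1 hE, hr, rfl⟩)⟩
  · intro i hi b E hE
    replace hE := mem_canon_choiceName.1 hE
    exact ⟨mem_canon_levelName.2 (.inr ⟨rfl, i, hi, .inr ⟨b, hE⟩⟩),
      mem_canon_exWord.2 (markReach_of_triggers hne hi (.inr ⟨b, hE⟩))⟩
  · intro E
    constructor
    · rintro (h | ⟨h, -⟩ | ⟨-, h, h'⟩)
      · exact ⟨mem_canon_levelName.2 (.inr ⟨rfl, 0, hn, .inl h⟩),
          fun i hi => mem_canon_exWord.2 (markReach_of_triggers hne hi (.inl h))⟩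
      · simp [levelName, goalName] at h
      · exact ⟨mem_canon_levelName.2 h, fun i hi => mem_canon_exWord.2 (h' i hi)⟩
    · exact fun h => .inr (.inr ⟨rfl, mem_canon_levelName.1 h.1,
        fun i hi => mem_canon_exWord.1 (h.2 i hi)⟩)

lemma not_conceptTriggers_exWord {i r : ℕ} {v : List ℕ} {C : Concept} :
    ¬ ConceptTriggers i (exWord (r :: v) C) := by
  rintro (h | ⟨b, h⟩) <;> cases h

lemma not_hasLevel_exWord {j r : ℕ} {v : List ℕ} {C : Concept} :
    ¬ HasLevel n j (exWord (r :: v) C) := by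
  rintro (h | ⟨-, i, -, h⟩)
  · cases h
  · exact not_conceptTriggers_exWord h

/-- The hidden path is indistinguishable from the binary tree, up to the marker at its end. -/
lemma mem_ext_of_mem_canon_suffix {I : Interpretation} (hI : IsTreeModel n I) {i : ℕ}
    {D : Concept} {v : List ℕ} {k : ℕ} (hk : k + v.length = n) (hv : ∀ r ∈ v, r < 2)
    (hD : v ∉ D.paths) (h : exWord v (atom (markName i)) ∈ (canon n σ).ext D)
    {e : I.Dom} (he : e ∈ I.concept (levelName k)) : e ∈ I.ext D := by
  induction D generalizing v k e with
  | top => trivial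
  | atom B =>
    cases v with
    -- Every concept has the empty path, so `hD` keeps `D` away from the marked end.
    | nil => exact (hD (nil_mem_paths _)).elim
    | cons r v =>
      rcases h with h | ⟨-, h⟩ | ⟨-, h, -⟩
      · cases h
      · exact (not_hasLevel_exWord h).elim
      · exact (not_hasLevel_exWord h).elim
  | inter C D hC hD' =>
    simp only [paths, Finset.mem_union, not_or] at hD
    exact ⟨hC hk hv hD.1 h.1 he, hD' hk hv hD.2 h.2 he⟩
  | ex s D ih =>
    cases v with
    | nil => exact (hD (nil_mem_paths _)).elim
    | cons r v =>
      -- Inside the hidden path there are no levels or triggers, so the next letter is the only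
      -- edge.
      obtain ⟨F, hF, h | ⟨j, -, h, -⟩ | ⟨i', -, h, -⟩⟩ := h
      · cases h
        simp only [List.length_cons] at hk
        obtain ⟨e', he', hr⟩ := hI k (by omega) e he s (hv s List.mem_cons_self)
        refine ⟨e', ih (k := k + 1) (by omega) (fun t ht => hv t (by simp [ht])) ?_ hF he', hr⟩
        intro hp
        exact hD (by simp [paths, hp])
      · exact (not_hasLevel_exWord h).elim
      · exact (not_conceptTriggers_exWord h).elim

lemma triggers_of_conceptTriggers {I : Interpretation} {i : ℕ} {E : Concept}
    (h : ConceptTriggers i E) {e : I.Dom} (he : e ∈ I.ext E) : Triggers I i e := by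
  rcases h with h | ⟨b, h⟩
  · exact .inl (I.mem_ext_of_mem_conjuncts h he)
  · exact .inr ⟨b, I.mem_ext_of_mem_conjuncts h he⟩

lemma mem_concept_of_hasLevel {I : Interpretation} (hI : IsCommonModel n I) {j : ℕ} {E : Concept}
    (h : HasLevel n j E) {e : I.Dom} (he : e ∈ I.ext E) : e ∈ I.concept (levelName j) := by
  rcases h with h | ⟨rfl, i, hi, h⟩
  · exact I.mem_ext_of_mem_conjuncts h he
  · exact hI.2.1 i hi e (triggers_of_conceptTriggers h he)

/-- Each step of the canonical model is imitated in `I`. By `hE` the markers behind a derived goal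
name come from triggers and not from explicit paths. By `hD` the concept `D` cannot follow the
hidden path to its end, so the binary tree can stand in for it. -/
lemma mem_ext_of_mem_canon {I : Interpretation} (hI : IsCommonModel n I) (hn : 1 ≤ n)
    (hσ : σ.length = n) (hσ2 : ∀ r ∈ σ, r < 2) {D E : Concept} (hD : Avoids σ D)
    (hE : Avoids σ E) (h : E ∈ (canon n σ).ext D) {e : I.Dom} (he : e ∈ I.ext E) :
    e ∈ I.ext D := by
  have hne : σ ≠ [] := by
    rintro rfl
    simp at hσ
    omega
  induction D generalizing E e with
  | top => trivial
  | atom B =>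
    rcases h with h | ⟨rfl, h⟩ | ⟨rfl, h, h'⟩
    · exact I.mem_ext_of_mem_conjuncts h he
    · exact mem_concept_of_hasLevel hI h he
    · refine hI.2.2 e fun i hi => ?_
      rcases markAt_or_of_markReach hne le_rfl (h' i hi) with h | ⟨-, h⟩
      · exact (hE [] h.mem_paths).elim
      · exact triggers_of_conceptTriggers h he
  | inter C D hC hD' => exact ⟨hC hD.left hE h.1 he, hD' hD.right hE h.2 he⟩
  | ex r D ih =>
    obtain ⟨F, hF, h | ⟨j, hj, h, hr, rfl⟩ | ⟨i, hi, h, w, rfl, rfl⟩⟩ := h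
    · obtain ⟨e', he', hr⟩ := I.mem_ext_of_mem_conjuncts h he
      exact ⟨e', ih hD.of_ex (hE.of_mem_conjuncts h) hF he', hr⟩
    · obtain ⟨e', he', hr⟩ := hI.1 j hj e (mem_concept_of_hasLevel hI h he) r hr
      exact ⟨e', ih hD.of_ex (avoids_exWord_atom (w := []) (by simp; omega)) hF he', hr⟩
    · have h0 := mem_concept_of_hasLevel hI (.inr ⟨rfl, i, hi, h⟩) he
      obtain ⟨e', he', hr⟩ := hI.1 0 hn e h0 r (hσ2 r (by simp))
      simp only [List.length_cons] at hσ
      refine ⟨e', mem_ext_of_mem_canon_suffix hI.1 (k := 1) (by omega)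
        (fun s hs => hσ2 s (by simp [hs])) ?_ hF he', hr⟩
      intro hp
      exact hD [] (by simp [paths, hp])

/-- An inclusion that follows from one target and does not contain its hidden word holds in all
common models. -/
lemma satisfies_of_entails {I : Interpretation} (hI : IsCommonModel n I) (hn : 1 ≤ n)
    (hσ : σ.length = n) (hσ2 : ∀ r ∈ σ, r < 2) {α : CI} (hl : Avoids σ α.lhs)
    (hr : Avoids σ α.rhs) (h : (hiddenTBox n σ).Entails α) : I.Satisfies α :=
  fun _ he => mem_ext_of_mem_canon hI hn hσ hσ2 hr hl
    (h _ (isModel_canon hn hσ) (mem_canon_of_conjuncts_subset subset_rfl)) he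

end Canon

/-! ### Hypotheses -/

/-- The chain that satisfies exactly the consequences of the names in `Z` and the first level. -/
def chain (n : ℕ) (Z : List ℕ) : Interpretation where
  Dom := ℕ
  nonempty := ⟨0⟩
  concept B := {d | B = levelName d ∨ d = 0 ∧ B ∈ Z}
  role r := {p | p.1 < n ∧ r < 2 ∧ p.2 = p.1 + 1}

/-- The concept that generates the elements of the chain from `d` on. -/
def chainConcept (Z : List ℕ) (d : ℕ) : Concept :=
  if d = 0 then inter (atom (levelName 0)) (conj (Z.map atom)) else atom (levelName d)

section Chain

variable {n : ℕ} {Z Z' : List ℕ}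

lemma size_chainConcept_le (d : ℕ) : (chainConcept Z d).size ≤ 2 * Z.length + 3 := by
  unfold chainConcept
  split
  · have := size_conj_le (l := Z.map atom) (b := 1) (by simp [size])
    simp only [List.length_map] at this
    simp only [size]
    omega
  · simp only [size]
    omega

lemma mem_ext_chainConcept {I : Interpretation} {d : ℕ} {e : I.Dom} :
    e ∈ I.ext (chainConcept Z d) ↔
      e ∈ I.concept (levelName d) ∧ (d = 0 → ∀ B ∈ Z, e ∈ I.concept B) := by
  unfold chainConcept
  split
  · next h =>
    subst h
    simp only [Interpretation.ext, Set.mem_inter_iff, Interpretation.mem_ext_conj]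
    simp [Interpretation.ext]
  · next h => simp [Interpretation.ext, h]

lemma mem_chain_chainConcept (d : ℕ) : (d : (chain n Z).Dom) ∈ (chain n Z).ext (chainConcept Z d) :=
  mem_ext_chainConcept.2 ⟨.inl rfl, fun h _ hB => .inr ⟨h, hB⟩⟩

/-- The chain is the binary tree with each level collapsed to a point, so a tree model can follow
every branch that `P` has in it. -/
lemma mem_ext_of_mem_chain {I : Interpretation} (hI : IsTreeModel n I) {P : Concept} {d : ℕ}
    (h : (d : (chain n Z).Dom) ∈ (chain n Z).ext P) {e : I.Dom}
    (he : e ∈ I.ext (chainConcept Z d)) : e ∈ I.ext P := by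
  induction P generalizing d e with
  | top => trivial
  | atom B =>
    rw [mem_ext_chainConcept] at he
    rcases h with rfl | ⟨rfl, h⟩
    · exact he.1
    · exact he.2 rfl B h
  | inter C D hC hD => exact ⟨hC h.1 he, hD h.2 he⟩
  | ex r C ih =>
    obtain ⟨d', hd', h1, h2, h3⟩ := h
    simp only at h1 h3
    subst h3
    rw [mem_ext_chainConcept] at he
    obtain ⟨e', he', hr⟩ := hI d h1 e he.1 r h2
    exact ⟨e', ih hd' (mem_ext_chainConcept.2 ⟨he', by omega⟩), hr⟩

/-- One failing branch of `Q` is enough, and it can be cut off with `∃r.⊤` as soon as it leaves the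
chain. -/
lemma exists_small_not_mem_chain {Q : Concept} {d : ℕ}
    (h : (d : (chain n Z).Dom) ∉ (chain n Z).ext Q) :
    ∃ C : Concept, C.size ≤ 2 * (n - d) + 3 ∧ (d : (chain n Z).Dom) ∉ (chain n Z).ext C ∧
      ∀ I : Interpretation, I.ext Q ⊆ I.ext C := by
  induction Q generalizing d with
  | top => exact (h trivial).elim
  | atom B => exact ⟨atom B, by simp [size], h, fun _ => subset_rfl⟩
  | inter C D hC hD =>
    by_cases h' : (d : (chain n Z).Dom) ∈ (chain n Z).ext C
    · obtain ⟨C', h1, h2, h3⟩ := hD fun h'' => h ⟨h', h''⟩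
      exact ⟨C', h1, h2, fun I e he => h3 I he.2⟩
    · obtain ⟨C', h1, h2, h3⟩ := hC h'
      exact ⟨C', h1, h2, fun I e he => h3 I he.1⟩
  | ex r C ih =>
    by_cases hd : d < n ∧ r < 2
    · obtain ⟨C', h1, h2, h3⟩ := ih (d := d + 1) fun h' => h ⟨_, h', hd.1, hd.2, rfl⟩
      refine ⟨ex r C', by simp only [size]; omega, ?_, ?_⟩
      · rintro ⟨d', hd', -, -, h6⟩
        simp only at h6
        subst h6
        exact h2 hd'
      · rintro I e ⟨e', he', hr⟩
        exact ⟨e', h3 I he', hr⟩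
    · refine ⟨ex r top, by simp [size], ?_, ?_⟩
      · rintro ⟨d', -, h4, h5, -⟩
        exact hd ⟨h4, h5⟩
      · rintro I e ⟨e', he', hr⟩
        exact ⟨e', trivial, hr⟩

/-- No edge of the chain leads to 0, where the names of `Z` sit, so they matter only to top-level
conjuncts. -/
lemma mem_chain_of_mem_chain {P : Concept} {d : ℕ}
    (hZ : d = 0 → ∀ B ∈ Z, atom B ∈ P.conjuncts → B ∈ Z')
    (h : (d : (chain n Z).Dom) ∈ (chain n Z).ext P) :
    (d : (chain n Z').Dom) ∈ (chain n Z').ext P := by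
  induction P generalizing d with
  | top => trivial
  | atom B =>
    rcases h with h | ⟨h, h'⟩
    · exact .inl h
    · exact .inr ⟨h, hZ h B h' rfl⟩
  | inter C D hC hD =>
    exact ⟨hC (fun h0 B hB hB' => hZ h0 B hB (.inl hB')) h.1,
      hD (fun h0 B hB hB' => hZ h0 B hB (.inr hB')) h.2⟩
  | ex r C ih =>
    obtain ⟨d', hd', h1, h2, h3⟩ := h
    simp only at h1 h3
    subst h3
    exact ⟨d + 1, ih (by omega) hd', h1, h2, rfl⟩

/-- With both choices for `i` absent nothing triggers `i`, and the rule for the goal name never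
applies. -/
lemma isCommonModel_chain {i : ℕ} (hi : i < n) (hg : goalName ∉ Z) (hl : ∀ j, levelName j ∉ Z)
    (hb : ∀ b, choiceName b i ∉ Z) : IsCommonModel n (chain n Z) := by
  have hlg : ∀ d, goalName ≠ levelName d := by
    intro d h
    simp [goalName, levelName] at h
  have hlc : ∀ b i d, choiceName b i ≠ levelName d := by
    intro b i d h
    cases b <;> simp [choiceName, levelName] at h <;> omega
  refine ⟨?_, ?_, ?_⟩
  · rintro j hj d (hd | ⟨-, hd⟩) r hr
    · obtain rfl : j = d := by simp only [levelName] at hd; omega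
      exact ⟨j + 1, .inl rfl, hj, hr, rfl⟩
    · exact (hl _ hd).elim
  · rintro j hj d ((h | ⟨-, h⟩) | ⟨b, h | ⟨rfl, h⟩⟩)
    · exact (hlg _ h).elim
    · exact (hg h).elim
    · exact (hlc _ _ _ h).elim
    · exact .inl rfl
  · intro d hd
    rcases hd i hi with (h | ⟨-, h⟩) | ⟨b, h | ⟨-, h⟩⟩
    · exact (hlg _ h).elim
    · exact (hg h).elim
    · exact (hlc _ _ _ h).elim
    · exact (hb b h).elim

end Chain

/-! ### Counting the targets that entail an inclusion -/

/-- The role word given by a binary sequence. -/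
def binaryWord {n : ℕ} (f : Fin n → Fin 2) : List ℕ := List.ofFn fun i => (f i : ℕ)

lemma length_binaryWord {n : ℕ} (f : Fin n → Fin 2) : (binaryWord f).length = n := by
  simp [binaryWord]

lemma lt_two_of_mem_binaryWord {n : ℕ} (f : Fin n → Fin 2) : ∀ r ∈ binaryWord f, r < 2 := by
  intro r hr
  simp only [binaryWord, List.mem_ofFn] at hr
  obtain ⟨i, rfl⟩ := hr
  exact (f i).2

lemma binaryWord_injective {n : ℕ} :
    Function.Injective (binaryWord : (Fin n → Fin 2) → List ℕ) := by
  intro f g h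
  funext i
  exact Fin.ext (congrFun (List.ofFn_injective h) i)

/-- The target given by a binary sequence. -/
noncomputable def target {n : ℕ} (f : Fin n → Fin 2) : TBox := hiddenTBox n (binaryWord f)

lemma sig_target {n : ℕ} (hn : 1 ≤ n) (f g : Fin n → Fin 2) : (target f).sig = (target g).sig := by
  refine Prod.ext (sig_hiddenTBox_fst _ _ _) ?_
  rw [target, target, sig_hiddenTBox_snd hn (lt_two_of_mem_binaryWord f),
    sig_hiddenTBox_snd hn (lt_two_of_mem_binaryWord g)]

lemma ncard_not_avoids_binaryWord_le {n : ℕ} (α : CI) :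
    {f : Fin n → Fin 2 | ¬ (Avoids (binaryWord f) α.lhs ∧ Avoids (binaryWord f) α.rhs)}.ncard ≤
      α.size := by
  have h : {f : Fin n → Fin 2 | ¬ (Avoids (binaryWord f) α.lhs ∧ Avoids (binaryWord f) α.rhs)} =
      {f | ¬ Avoids (binaryWord f) α.lhs} ∪ {f | ¬ Avoids (binaryWord f) α.rhs} := by
    ext f
    simp only [Set.mem_ofPred_eq, Set.mem_union]
    tauto
  rw [h]
  exact (Set.ncard_union_le _ _).trans (add_le_add
    (ncard_not_avoids_le binaryWord_injective length_binaryWord _)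
    (ncard_not_avoids_le binaryWord_injective length_binaryWord _))

lemma ncard_entails_le {n : ℕ} (hn : 1 ≤ n) {α : CI}
    (hα : ¬ ∀ f : Fin n → Fin 2, (target f).Entails α) :
    {f : Fin n → Fin 2 | (target f).Entails α}.ncard ≤ α.size := by
  refine (Set.ncard_le_ncard ?_ (Set.toFinite _)).trans (ncard_not_avoids_binaryWord_le α)
  rintro f hf ⟨hl, hr⟩
  exact hα fun g I hI => satisfies_of_entails (IsCommonModel.of_isModel hn hI) hn
    (length_binaryWord f) (lt_two_of_mem_binaryWord f) hl hr hf

/-- Fewer than `2 ^ n` words occur in `α`, so it avoids one, and the target with that word suffices.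
A common model need not be a model of any target. -/
lemma satisfies_of_forall_entails {n : ℕ} (hn : 1 ≤ n) {α : CI} (hs : α.size < 2 ^ n)
    (hα : ∀ f : Fin n → Fin 2, (target f).Entails α) {I : Interpretation}
    (hI : IsCommonModel n I) : I.Satisfies α := by
  by_contra hsat
  have huniv : {f : Fin n → Fin 2 |
      ¬ (Avoids (binaryWord f) α.lhs ∧ Avoids (binaryWord f) α.rhs)} = Set.univ := by
    refine Set.eq_univ_of_forall fun f h => hsat ?_
    exact satisfies_of_entails hI hn (length_binaryWord f) (lt_two_of_mem_binaryWord f) h.1 h.2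
      (hα f)
  have h := ncard_not_avoids_binaryWord_le (n := n) α
  rw [huniv, Set.ncard_univ] at h
  simp at h
  omega

/-- A choice name guarantees its marker along the hidden word and along no other word of that
length. -/
lemma exists_separating {n : ℕ} (hn : 1 ≤ n) {f g : Fin n → Fin 2} (hfg : f ≠ g) :
    ∃ α : CI, (target f).Entails α ∧ ¬ (target g).Entails α ∧ α.size = 2 * n + 2 := by
  refine ⟨⟨atom (choiceName false 0), exWord (binaryWord f) (atom (markName 0))⟩, ?_, ?_, ?_⟩
  · intro I hI d hd
    exact ((isModel_hiddenTBox.1 hI).2.1 0 hn false d hd).2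
  · intro h
    have h1 := mem_canon_exWord.1 (h _ (isModel_canon hn (length_binaryWord g))
      (mem_canon_of_conjuncts_subset subset_rfl))
    have hne : binaryWord f ≠ [] := by
      rw [← List.length_pos_iff_ne_nil, length_binaryWord]
      exact hn
    rcases markAt_or_of_markReach hne (by simp [length_binaryWord]) h1 with h2 | ⟨h2, -⟩
    · exact hne (markAt_atom h2).1
    · exact hfg (binaryWord_injective h2.symm)
  · simp only [CI.size, size, size_exWord, length_binaryWord]
    omega

lemma Concept.one_le_size (C : Concept) : 1 ≤ C.size := by
  cases C <;> simp only [size] <;> omega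

lemma TBox.card_le_size (H : TBox) : H.card ≤ H.size := by
  rw [Finset.card_eq_sum_ones]
  refine Finset.sum_le_sum fun α _ => ?_
  have := α.lhs.one_le_size
  simp only [CI.size]
  omega

/-! ### An exponential lower bound for hypotheses -/

/-- The names chosen by a binary sequence. -/
def chosenNames {n : ℕ} (c : Fin n → Bool) : List ℕ :=
  (List.finRange n).map fun i => choiceName (c i) i

lemma length_chosenNames {n : ℕ} (c : Fin n → Bool) : (chosenNames c).length = n := by
  simp [chosenNames]

lemma choiceName_inj {b b' : Bool} {i i' : ℕ} (h : choiceName b i = choiceName b' i') :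
    b = b' ∧ i = i' := by
  cases b <;> cases b' <;> simp [choiceName] at h ⊢ <;> omega

lemma choiceName_mem_chosenNames {n : ℕ} {c : Fin n → Bool} {b : Bool} {i : Fin n} :
    choiceName b i ∈ chosenNames c ↔ c i = b := by
  simp only [chosenNames, List.mem_map, List.mem_finRange, true_and]
  constructor
  · rintro ⟨j, hj⟩
    obtain ⟨h1, h2⟩ := choiceName_inj hj
    rw [← Fin.ext h2, h1]
  · rintro rfl
    exact ⟨i, rfl⟩

lemma goalName_notMem_chosenNames {n : ℕ} (c : Fin n → Bool) : goalName ∉ chosenNames c := by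
  simp [chosenNames, choiceName, goalName]

lemma levelName_notMem_chosenNames {n : ℕ} (c : Fin n → Bool) (j : ℕ) :
    levelName j ∉ chosenNames c := by
  simp only [chosenNames, List.mem_map, List.mem_finRange, true_and, not_exists]
  intro i h
  cases hc : c i <;> simp [hc, choiceName, levelName] at h <;> omega

lemma four_mul_add_seven_lt_two_pow {n : ℕ} (hn : 6 ≤ n) : 4 * n + 7 < 2 ^ n := by
  induction n, hn using Nat.le_induction with
  | base => norm_num
  | succ n hn ih => rw [pow_succ]; omega

/-- A hypothesis that agrees with the common consequences of all targets on small inclusions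
needs an inclusion for every sequence of choices. -/
lemma exists_inclusion_of_choice {n : ℕ} (hn : 6 ≤ n) {H : TBox}
    (hH : ∀ α : CI, α.size ≤ 4 * n + 7 →
      (H.Entails α ↔ ∀ f : Fin n → Fin 2, (target f).Entails α)) (c : Fin n → Bool) :
    ∃ α ∈ H, ((0 : ℕ) : (chain n (chosenNames c)).Dom) ∈ (chain n (chosenNames c)).ext α.lhs ∧
      ∀ i, atom (choiceName (c i) i) ∈ α.lhs.conjuncts := by
  have hpow := four_mul_add_seven_lt_two_pow hn
  have hn1 : 1 ≤ n := by omega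
  have htree : ∀ I : Interpretation, I.IsModel H → IsTreeModel n I := by
    intro I hI j hj d hd r hr
    refine (hH ⟨atom (levelName j), ex r (atom (levelName (j + 1)))⟩ ?_).2 ?_ I hI hd
    · simp only [CI.size, size]
      omega
    · intro f J hJ e he
      exact (isModel_hiddenTBox.1 hJ).1 j hj e he r hr
  -- A violated inclusion of `H` would give the small inclusion `chainConcept Z d ⊑ C`. It is
  -- entailed by `H`, hence by all targets, hence true in the chain.
  have hchain : ∀ Z : List ℕ, Z.length ≤ n → IsCommonModel n (chain n Z) → ∀ α ∈ H,
      (chain n Z).Satisfies α := by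
    intro Z hZ hcom α hα d hd
    by_contra hd'
    obtain ⟨C, hC, hdC, hIC⟩ := exists_small_not_mem_chain hd'
    have hsize := size_chainConcept_le (Z := Z) d
    have hsmall : (CI.mk (chainConcept Z d) C).size ≤ 4 * n + 7 := by
      simp only [CI.size]
      omega
    refine hdC (satisfies_of_forall_entails hn1 (hsmall.trans_lt hpow) ((hH _ hsmall).1 ?_) hcom
      (mem_chain_chainConcept d))
    intro I hI e he
    exact hIC I (hI α hα (mem_ext_of_mem_chain (htree I hI) hd he))
  set Z := chosenNames c with hZ
  have hgoal : H.Entails ⟨chainConcept Z 0, atom goalName⟩ := by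
    have hsize : (chainConcept Z 0).size ≤ 2 * n + 3 := by
      simpa only [hZ, length_chosenNames] using size_chainConcept_le (Z := Z) 0
    refine (hH _ (by simp only [CI.size, size]; omega)).2 fun f I hI e he => ?_
    refine (IsCommonModel.of_isModel hn1 hI).2.2 e fun i hi => .inr ⟨c ⟨i, hi⟩, ?_⟩
    exact (mem_ext_chainConcept.1 he).2 rfl _
      (choiceName_mem_chosenNames (i := ⟨i, hi⟩).2 rfl)
  -- With a complete selection the chain still lacks the goal name, so `H` must exclude it.
  have hnot : ¬ (chain n Z).IsModel H := by
    intro h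
    rcases hgoal _ h (mem_chain_chainConcept 0) with h | ⟨-, h⟩
    · simp [goalName, levelName] at h
    · exact goalName_notMem_chosenNames c h
  simp only [Interpretation.IsModel, Interpretation.Satisfies, Set.not_subset, not_forall] at hnot
  obtain ⟨α, hα, (d : ℕ), hd, hd'⟩ := hnot
  -- Away from 0 the violation would persist with no chosen names at all.
  obtain rfl : d = 0 := by
    by_contra h0
    refine hd' (mem_chain_of_mem_chain (Z := []) (by simp) ?_)
    exact hchain [] (by simp) (isCommonModel_chain (i := 0) hn1 (by simp) (by simp) (by simp)) α hα
      (mem_chain_of_mem_chain (fun h => (h0 h).elim) hd)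
  refine ⟨α, hα, hd, fun i => ?_⟩
  by_contra hi
  -- If the left-hand side did not demand this name, the violation would survive its deletion,
  -- although the smaller chain is a common model.
  set Z' := Z.filter (· ≠ choiceName (c i) i) with hZ'
  have hsub : ∀ B ∈ Z', B ∈ Z := fun B hB => List.mem_of_mem_filter hB
  refine hd' (mem_chain_of_mem_chain (Z := Z') (fun _ B hB _ => hsub B hB) ?_)
  refine hchain Z' ((List.length_filter_le _ _).trans (length_chosenNames c).le)
    (isCommonModel_chain i.2 (fun h => goalName_notMem_chosenNames c (hsub _ h))
      (fun j h => levelName_notMem_chosenNames c j (hsub _ h)) ?_) α hα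
    (mem_chain_of_mem_chain (fun _ B hB hB' => ?_) hd)
  · intro b hb
    have h1 := choiceName_mem_chosenNames.1 (hsub _ hb)
    rw [hZ', List.mem_filter, h1] at hb
    simp at hb
  · rw [hZ', List.mem_filter]
    refine ⟨hB, ?_⟩
    simp only [ne_eq, decide_eq_true_eq]
    rintro rfl
    exact hi hB'

/-- Small hypotheses differ from the common consequences of all targets on a small inclusion. -/
lemma exists_small_difference {n : ℕ} (hn : 6 ≤ n) {H : TBox} (hs : H.size < 2 ^ n) :
    ∃ α : CI, α.size ≤ 4 * n + 7 ∧
      ¬ (H.Entails α ↔ ∀ f : Fin n → Fin 2, (target f).Entails α) := by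
  by_contra hcon
  push Not at hcon
  choose α hα h0 hc using exists_inclusion_of_choice hn hcon
  -- The left-hand side for `c` holds at 0 in the chain of `c`; if it also served `c'`, all names
  -- chosen by `c'` would hold there.
  have hinj : Function.Injective fun c => (⟨α c, hα c⟩ : H) := by
    intro c c' h
    have h' : α c = α c' := congrArg Subtype.val h
    funext i
    have h1 := hc c' i
    rw [← h'] at h1
    rcases Interpretation.mem_ext_of_mem_conjuncts _ h1 (h0 c) with h2 | ⟨-, h2⟩
    · cases hb : c' i <;> simp [hb, choiceName, levelName] at h2
    · exact choiceName_mem_chosenNames.1 h2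
  have h1 := Fintype.card_le_of_injective _ hinj
  have h2 := H.card_le_size
  simp at h1
  omega

lemma TBox.entails_of_size_eq_zero {H : TBox} (hH : H.size = 0) {α : CI} (hα : H.Entails α)
    (T : TBox) : T.Entails α := by
  have h : H = ∅ := by
    have := H.card_le_size
    rw [← Finset.card_eq_zero]
    omega
  subst h
  exact fun I _ => hα I (by simp [Interpretation.IsModel])

/-! ### Non-learnability -/

/-- No framework whose representations are EL TBoxes, among them the targets, admits
polynomial query learning. -/
lemma not_polyQueryLearnableOn {L : Type} (toTBox : L → TBox) (𝒯 : Set L)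
    (hL : ∀ (n : ℕ) (f : Fin n → Fin 2), ∃ l ∈ 𝒯, toTBox l = target f) :
    ¬ (LearningFramework.mk CI L (fun l => {α | (toTBox l).Entails α}) CI.size
        fun l => (toTBox l).size).PolyQueryLearnableOn (fun l => (toTBox l).sig) 𝒯 := by
  refine LearningFramework.not_polyQueryLearnableOn_of_families
    ((3 * .X + 1) * 2 * (2 * .X ^ 2 + 2 * .X + 8)) (4 * .X + 7) 6 fun n hn => ?_
  have hn1 : 1 ≤ n := by omega
  choose T hT hTt using hL n
  refine ⟨T, hT, ?_, ?_, ?_, ?_, ?_, ?_⟩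
  · intro f g
    simp only [hTt]
    exact sig_target hn1 f g
  · intro f
    simp only [hTt, target]
    simpa using size_hiddenTBox_le (length_binaryWord f)
  · intro f g hfg
    obtain ⟨α, h1, h2, h3⟩ := exists_separating hn1 hfg
    refine ⟨α, .inl ⟨?_, ?_⟩, ?_⟩
    · simpa [hTt] using h1
    · simpa [hTt] using h2
    · simp [h3]
      omega
  · intro α hα
    simp only [hTt, Set.mem_ofPred_eq] at hα ⊢
    exact ncard_entails_le hn1 hα
  · intro h hh
    obtain ⟨α, h1, h2⟩ := exists_small_difference hn hh
    refine ⟨α, by simpa using h1, ?_⟩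
    simpa only [hTt, Set.mem_ofPred_eq] using h2
  · intro h hh α hα f
    exact TBox.entails_of_size_eq_zero hh hα _

end EL

/-- EL TBoxes are not polynomial query learnable using membership and equivalence queries, and
neither are acyclic EL TBoxes, whether the hypotheses have to be acyclic or not. The signature
of the target is known to the learner. -/
theorem theorem4 :
    ¬ EL.framework.PolyQueryLearnable EL.TBox.sig ∧
    ¬ EL.acyclicFramework.PolyQueryLearnable (fun T => EL.TBox.sig T.1) ∧
    ¬ EL.framework.PolyQueryLearnableOn EL.TBox.sig {T | EL.TBox.Acyclic T} :=
  ⟨EL.not_polyQueryLearnableOn id Set.univ fun _ f => ⟨EL.target f, trivial, rfl⟩,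
    EL.not_polyQueryLearnableOn Subtype.val Set.univ
      fun _ f => ⟨⟨EL.target f, EL.acyclic_hiddenTBox _ _⟩, trivial, rfl⟩,
    EL.not_polyQueryLearnableOn id {T | EL.TBox.Acyclic T}
      fun _ f => ⟨EL.target f, EL.acyclic_hiddenTBox _ _, rfl⟩⟩
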